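/- Consider the discrete-time Poisson channel with input $X\ge 0$ and output $Y\in\{0,1,2,\dots\}$, $P_{Y|X}(y|x)=\frac{1}{y!}x^y e^{-x}$ (with $0^0=1$). For $A\ge 0$ let $C(A)=\max_{X:\,0\le X\le A} I(X;Y)$ be its capacity in nats under the amplitude constraint $0\le X\le A$, the maximum being over all laws of $X$ on $[0,A]$; logarithms are natural. For every $A\ge 0$ the capacity is finite and the maximum is attained, and every capacity-achieving input law $P_{X^\star}$, with induced output law $P_{Y^\star}$, has the following properties. (Here $\mathrm{supp}(P)$ is the set of points all of whose neighbourhoods have positive probability, and $\frac{C(A)}{1-e^{-A}}$ is read as $0$ when $A=0$.) (i) $C(A)=\log\frac{1}{P_{Y^\star}(0)}$. (ii) For every $x\in\mathrm{supp}(P_{X^\star})$, $P_{X^\star}(x)\le e^{-\frac{C(A)}{1-e^{-A}}}$; for every $x\in\mathrm{supp}(P_{X^\star})\setminus\{0\}$, $P_{X^\star}(x)\le e^{-C(A)-x\frac{e^{-x}}{1-e^{-x}}}$, and this last bound holds with equality if $|\mathrm{supp}(P_{X^\star})|=2$. (iii) If $e^{\frac{C(A)}{1-e^{-A}}}\ge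 4$, then $$P_{X^\star}(A)\ \ge\ \frac{1-3e^{-\frac{C(A)}{1-e^{-A}}}}{2A^{2Ae\log(A)+2}\,e^{-2A+1}}.$$ (iv) For every $x^\star\in\mathrm{supp}(P_{X^\star})\setminus\{0,A\}$, $$e^{-\sqrt{2(\log(A)-1)}}\le A\,e^{W_{-1}(-1/A)}\le x^\star\le A\,e^{W_0(-1/A)}\le A-1,$$ where $W_0\ge -1$ and $W_{-1}\le -1$ denote the two real branches of the Lambert function (the solutions $y$ of $ye^y=x$ for $-1/e\le x<0$). (v) $\mathrm{supp}(P_{X^\star})$ is finite and $|\mathrm{supp}(P_{X^\star})|\ge e^{\frac{C(A)}{1-e^{-A}}}$. This lower bound is of exact order $\sqrt A$ as $A\to\infty$. (vi) $P_{X^\star}(A)>0$ and $|\mathrm{supp}(P_{X^\star})|\le\lceil A-\log P_{X^\star}(A)-C(A)\rceil+2$. If moreover $e^{\frac{C(A)}{1-e^{-A}}}\ge 4$, then $$|\mathrm{supp}(P_{X^\star})|\le 2eA\log^2(A)+2\log(A)-A-\log\Big(\tfrac{1-3e^{-\frac{C(A)}{1-e^{-A}}}}{2}\Big)-C(A)+4,$$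 and the right-hand side is $O(A\log^2 A)$ as $A\to\infty$. Consequently there are constants $c_1,c_2>0$ such that for all sufficiently large $A$ and every capacity-achieving law, $c_1\sqrt A\le|\mathrm{supp}(P_{X^\star})|\le c_2A\log^2A$. -/

import Mathlib

open MeasureTheory ProbabilityTheory Filter Asymptotics
open scoped ENNReal NNReal

noncomputable section

namespace PoissonChannel

/-- The Poisson channel: given the input `x ≥ 0`, the output is Poisson distributed with mean `x`.
(The kernel is extended to negative `x` by the value at `0`; inputs are always nonnegative below.) -/
def channel : Kernel ℝ ℕ where
  toFun x := poissonMeasure x.toNNReal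
  measurable' := by
    refine Measure.measurable_of_measurable_coe _ fun s _ => ?_
    have h : ∀ x : ℝ, poissonMeasure x.toNNReal s
        = ∑' n : ℕ, ENNReal.ofReal
            (Real.exp (-(x.toNNReal : ℝ)) * (x.toNNReal : ℝ) ^ n / (n.factorial : ℝ)) *
              (Measure.dirac n) s := by
      intro x
      simp [poissonMeasure]
    simp_rw [h]
    fun_prop

instance : IsMarkovKernel channel :=
  ⟨fun x => inferInstanceAs (IsProbabilityMeasure (poissonMeasure x.toNNReal))⟩

/-- The channel has the transition probabilities `x ^ y * exp (-x) / y!`. -/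
theorem channel_real_singleton {x : ℝ} (hx : 0 ≤ x) (y : ℕ) :
    (channel x).real {y} = 1 / (y.factorial : ℝ) * x ^ y * Real.exp (-x) := by
  change (poissonMeasure x.toNNReal).real {y} = _
  rw [poissonMeasure_real_singleton, Real.coe_toNNReal x hx]
  ring

/-- `P` is the law of an input `X` with `0 ≤ X ≤ A`. -/
def IsInput (A : ℝ) (P : Measure ℝ) : Prop :=
  IsProbabilityMeasure P ∧ ∀ᵐ x ∂P, 0 ≤ x ∧ x ≤ A

/-- The law of the channel output `Y` when the input has law `P`. -/
def outputLaw (P : Measure ℝ) : Measure ℕ := P.bind channel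

/-- The mutual information `I(X;Y)` (in nats) when the input has law `P`: the relative entropy of
the joint law of `(X, Y)` with respect to the product of the marginal laws. -/
def mutualInfo (P : Measure ℝ) : ℝ≥0∞ :=
  InformationTheory.klDiv (P.compProd channel) (P.prod (outputLaw P))

/-- The capacity under the constraint `0 ≤ X ≤ A`, as an extended nonnegative real. -/
def capacityENN (A : ℝ) : ℝ≥0∞ := ⨆ (P : Measure ℝ) (_ : IsInput A P), mutualInfo P

/-- The capacity under the constraint `0 ≤ X ≤ A`, as a real number. -/
def capacity (A : ℝ) : ℝ := (capacityENN A).toReal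

/-- `P` is a capacity-achieving input law under the constraint `0 ≤ X ≤ A`. -/
def IsCapacityAchieving (A : ℝ) (P : Measure ℝ) : Prop :=
  IsInput A P ∧ mutualInfo P = capacityENN A

/-- The principal real branch of the Lambert function: for `-1/e ≤ x`, the solution `y ≥ -1`
of `y * exp y = x`. -/
def lambertW0 (x : ℝ) : ℝ := Function.invFunOn (fun y : ℝ => y * Real.exp y) (Set.Ici (-1)) x

/-- The lower real branch of the Lambert function: for `-1/e ≤ x < 0`, the solution `y ≤ -1`
of `y * exp y = x`. -/
def lambertWm1 (x : ℝ) : ℝ := Function.invFunOn (fun y : ℝ => y * Real.exp y) (Set.Iic (-1)) x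

/-- The lower bound `exp (C(A) / (1 - exp (-A)))` on the number of support points. -/
def supportLowerBound (A : ℝ) : ℝ := Real.exp (capacity A / (1 - Real.exp (-A)))

/-- The explicit upper bound on the number of support points. -/
def supportUpperBound (A : ℝ) : ℝ :=
  2 * Real.exp 1 * A * Real.log A ^ 2 + 2 * Real.log A - A
    - Real.log ((1 - 3 * Real.exp (-(capacity A / (1 - Real.exp (-A))))) / 2)
    - capacity A + 4

end PoissonChannel

end

noncomputable section

namespace PoissonChannel

open Topology

/-! ### Exponential generating functions and Poisson expectations -/

/-! Write m(y) = y!·P_Y(y) = E[X^y e^(-X)] (`mom`) and i(x) = D(Poisson(x) ‖ P_Y) = x log x - x - E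
log m(Y) with Y Poisson of mean x (`infoDensity`). Mutual information equals ∫ i dP. It is
continuous on the compact space of laws on [0,A], so a maximiser exists, and mixing a maximiser with
point masses gives the Kuhn-Tucker conditions: i ≤ C on [0,A], with equality on the support
(`infoDensity_le`, `infoDensity_eq`). For A > 0, almost everything is read off from these.

The derivative is i'(x) = log x - E log g(Y), where g(y) = m(y+1)/m(y) = E[X | Y=y] is nondecreasing
(`condMean_mono`). Its sign at an extreme support point forces 0 and A into the support, so C = i(0)
= -log P_Y(0). Inserting m(y) ≥ P(x) x^y e^(-x) into i(x) = C bounds the point masses, and summing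
these bounds to 1 bounds the support size from below. At an interior support point i' = 0 and i'' ≤
0; with g ≤ A this gives 1 ≤ x log(A/x), which locates the point by Lambert branches and isolates A,
so P(A) > 0.

For the upper bound on the support size, N interior points yield 2N+1 positive zeros of i', hence 2N
of i''. Up to the positive factor x e^x, i'' is the exponential generating function of 1 - y·Δ log
g(y). A rule of signs (`card_zeros_egf_le`) bounds its positive zeros by twice the number of y with
y·Δ log g(y) ≥ 1. These terms are nonnegative, and summation by parts with m(n) ≥ P(A) A^n e^(-A)
bounds their sum by A - log P(A) - C. The bound becomes explicit through `le_measureReal_right`: the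
second-order condition at the largest interior point prevents the posterior probability of A from
being small at an output of order A.

The growth of C comes from the uniform law on squares, which are spaced on the scale of the Poisson
standard deviation. As an input it bounds C from below, its output law as a reference measure bounds
C from above, and C = log √A + O(1). -/

/-- Sequences of at most exponential growth. -/
def ExpGrowth (a : ℕ → ℝ) : Prop := ∃ B : ℝ, 1 ≤ B ∧ ∀ n, |a n| ≤ B ^ (n + 1)

/-- The exponential generating function of a sequence. -/
def egf (a : ℕ → ℝ) (x : ℝ) : ℝ := ∑' n : ℕ, a n * (x ^ n / (n.factorial : ℝ))

/-- The expectation of `a Y` for `Y` Poisson distributed with mean `x`. -/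
def poissonExp (a : ℕ → ℝ) (x : ℝ) : ℝ := Real.exp (-x) * egf a x

namespace ExpGrowth

variable {a b : ℕ → ℝ}

theorem of_le (hb : ExpGrowth b) (h : ∀ n, |a n| ≤ |b n|) : ExpGrowth a := by
  obtain ⟨B, hB, hb⟩ := hb
  exact ⟨B, hB, fun n => (h n).trans (hb n)⟩

theorem add (ha : ExpGrowth a) (hb : ExpGrowth b) : ExpGrowth fun n => a n + b n := by
  obtain ⟨B, hB, ha⟩ := ha
  obtain ⟨D, hD, hb⟩ := hb
  refine ⟨B + D, by linarith, fun n => (abs_add_le _ _).trans ((add_le_add (ha n) (hb n)).trans ?_)⟩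
  exact pow_add_pow_le (by linarith) (by linarith) (by omega)

theorem mul (ha : ExpGrowth a) (hb : ExpGrowth b) : ExpGrowth fun n => a n * b n := by
  obtain ⟨B, hB, ha⟩ := ha
  obtain ⟨D, hD, hb⟩ := hb
  refine ⟨B * D, one_le_mul_of_one_le_of_one_le hB hD, fun n => ?_⟩
  rw [abs_mul, mul_pow]
  exact mul_le_mul (ha n) (hb n) (abs_nonneg _) (by positivity)

theorem const (c : ℝ) : ExpGrowth fun _ => c := by
  refine ⟨1 + |c|, by linarith [abs_nonneg c], fun n => ?_⟩
  have := one_le_pow₀ (n := n) (show 1 ≤ 1 + |c| by linarith [abs_nonneg c])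
  rw [pow_succ]
  nlinarith [abs_nonneg c]

theorem natCast : ExpGrowth fun n => (n : ℝ) := by
  refine ⟨2, by norm_num, fun n => ?_⟩
  rw [Nat.abs_cast]
  have : n < 2 ^ (n + 1) := Nat.lt_of_lt_of_le n.lt_two_pow_self (Nat.pow_le_pow_right (by norm_num) (by omega))
  exact_mod_cast this.le

theorem pow (c : ℝ) : ExpGrowth fun n => c ^ n := by
  refine ⟨1 + |c|, by linarith [abs_nonneg c], fun n => ?_⟩
  rw [abs_pow]
  calc |c| ^ n ≤ (1 + |c|) ^ n := by gcongr; linarith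
    _ ≤ _ := pow_le_pow_right₀ (by linarith [abs_nonneg c]) (by omega)

theorem shift (ha : ExpGrowth a) : ExpGrowth fun n => a (n + 1) := by
  obtain ⟨B, hB, ha⟩ := ha
  refine ⟨B ^ 2, one_le_pow₀ hB, fun n => (ha _).trans ?_⟩
  rw [← pow_mul]
  exact pow_le_pow_right₀ hB (by omega)

theorem unshift (ha : ExpGrowth fun n => a (n + 1)) : ExpGrowth a := by
  obtain ⟨B, hB, ha⟩ := ha
  refine ⟨B + |a 0|, by linarith [abs_nonneg (a 0)], fun n => ?_⟩
  rcases n with _ | n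
  · simp; linarith
  · refine (ha n).trans ?_
    calc B ^ (n + 1) ≤ (B + |a 0|) ^ (n + 1) := by gcongr; linarith [abs_nonneg (a 0)]
      _ ≤ _ := pow_le_pow_right₀ (by linarith [abs_nonneg (a 0)]) (by omega)

theorem neg (ha : ExpGrowth a) : ExpGrowth fun n => -a n := ha.of_le fun n => by simp

theorem sub (ha : ExpGrowth a) (hb : ExpGrowth b) : ExpGrowth fun n => a n - b n := by
  simpa [sub_eq_add_neg] using ha.add hb.neg

theorem diff (ha : ExpGrowth a) : ExpGrowth fun n => a (n + 1) - a n := ha.shift.sub ha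

theorem abs (ha : ExpGrowth a) : ExpGrowth fun n => |a n| := ha.of_le fun n => by simp

theorem summable (ha : ExpGrowth a) (x : ℝ) :
    Summable fun n => a n * (x ^ n / (n.factorial : ℝ)) := by
  obtain ⟨B, hB, ha⟩ := ha
  refine Summable.of_norm_bounded ((Real.summable_pow_div_factorial (B * |x|)).mul_left B) fun n => ?_
  rw [Real.norm_eq_abs, abs_mul, abs_div, abs_pow, Nat.abs_cast, mul_pow]
  calc |a n| * (|x| ^ n / n.factorial) ≤ B ^ (n + 1) * (|x| ^ n / n.factorial) := by
        gcongr; exact ha n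
    _ = _ := by ring

end ExpGrowth

variable {a b : ℕ → ℝ}

/-- Termwise differentiation shifts the coefficients; exponential growth supplies a summable bound
on every ball. -/
theorem egf_hasDerivAt (ha : ExpGrowth a) (x : ℝ) :
    HasDerivAt (egf a) (egf (fun n => a (n + 1)) x) x := by
  have hd : ∀ n : ℕ, ∀ y : ℝ, HasDerivAt (fun y : ℝ => a n * (y ^ n / (n.factorial : ℝ)))
      (a n * ((n : ℝ) * y ^ (n - 1) / (n.factorial : ℝ))) y := fun n y =>
    ((hasDerivAt_pow n y).div_const _).const_mul _
  have key : ∀ (y : ℝ) (n : ℕ), a (n + 1) * (((n + 1 : ℕ) : ℝ) * y ^ n / ((n + 1).factorial : ℝ))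
      = a (n + 1) * (y ^ n / (n.factorial : ℝ)) := by
    intro y n
    rw [Nat.factorial_succ]
    push_cast
    have := Nat.factorial_ne_zero n
    field_simp
  set R := |x| + 1
  have hsum : Summable fun n : ℕ => |a n * ((n : ℝ) * R ^ (n - 1) / (n.factorial : ℝ))| := by
    rw [← summable_nat_add_iff 1]
    refine (ha.shift.summable R).abs.congr fun n => ?_
    simp only [Nat.add_sub_cancel]
    rw [key]
  have h := hasDerivAt_tsum_of_isPreconnected (t := Metric.ball (0 : ℝ) R) (y₀ := 0) (y := x) hsum
    Metric.isOpen_ball (convex_ball _ _).isPreconnected (fun n y _ => hd n y) (fun n y hy => ?_)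
    (by simp [R]; positivity) (ha.summable 0) (by simp [R])
  · convert! h using 1
    have hs : Summable fun n : ℕ => a n * ((n : ℝ) * x ^ (n - 1) / (n.factorial : ℝ)) := by
      rw [← summable_nat_add_iff 1]
      refine (ha.shift.summable x).congr fun n => ?_
      simp only [Nat.add_sub_cancel]
      rw [key]
    rw [hs.tsum_eq_zero_add, egf]
    simp only [Nat.add_sub_cancel]
    simp only [key]
    simp
  · rw [Real.norm_eq_abs, abs_mul, abs_mul, abs_div, abs_div, abs_mul, abs_mul, abs_pow, abs_pow]
    have : |y| ≤ |R| := by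
      have := (mem_ball_zero_iff.mp hy).le
      rw [Real.norm_eq_abs] at this
      exact this.trans (le_abs_self _)
    gcongr

theorem egf_add (ha : ExpGrowth a) (hb : ExpGrowth b) (x : ℝ) :
    egf (fun n => a n + b n) x = egf a x + egf b x := by
  rw [egf, egf, egf, ← (ha.summable x).tsum_add (hb.summable x)]
  simp only [add_mul]

theorem egf_sub (ha : ExpGrowth a) (hb : ExpGrowth b) (x : ℝ) :
    egf (fun n => a n - b n) x = egf a x - egf b x := by
  rw [egf, egf, egf, ← (ha.summable x).tsum_sub (hb.summable x)]
  simp only [sub_mul]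

theorem egf_const_mul (c x : ℝ) : egf (fun n => c * a n) x = c * egf a x := by
  rw [egf, egf, ← tsum_mul_left]
  simp only [mul_assoc]

theorem egf_pow (c x : ℝ) : egf (fun n => c ^ n) x = Real.exp (c * x) := by
  rw [egf, Real.exp_eq_exp_ℝ, NormedSpace.exp_eq_tsum_div]
  simp only [mul_pow, mul_div_assoc]

theorem egf_natCast_mul (ha : ExpGrowth a) (x : ℝ) :
    egf (fun n => n * a n) x = x * egf (fun n => a (n + 1)) x := by
  rw [egf, (ExpGrowth.natCast.mul ha |>.summable x).tsum_eq_zero_add, egf, ← tsum_mul_left]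
  simp only [Nat.cast_zero, zero_mul, zero_add]
  congr 1
  ext n
  rw [Nat.factorial_succ]
  push_cast
  have := Nat.factorial_ne_zero n
  field_simp
  ring

theorem egf_pos (ha : ExpGrowth a) {x : ℝ} (hx : 0 < x) (h0 : ∀ n, 0 ≤ a n) {k : ℕ} (hk : 0 < a k) :
    0 < egf a x :=
  (ha.summable x).tsum_pos (fun n => mul_nonneg (h0 n) (by positivity)) k (by positivity)

theorem egf_continuous (ha : ExpGrowth a) : Continuous (egf a) :=
  continuous_iff_continuousAt.mpr fun x => (egf_hasDerivAt ha x).continuousAt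

theorem poissonExp_continuous (ha : ExpGrowth a) : Continuous (poissonExp a) :=
  (Real.continuous_exp.comp continuous_neg).mul (egf_continuous ha)

theorem poissonExp_hasDerivAt (ha : ExpGrowth a) (x : ℝ) :
    HasDerivAt (poissonExp a) (poissonExp (fun n => a (n + 1) - a n) x) x := by
  have h1 : HasDerivAt (fun y : ℝ => Real.exp (-y)) (-Real.exp (-x)) x := by
    simpa using (hasDerivAt_neg x).exp
  convert! h1.mul (egf_hasDerivAt ha x) using 1
  rw [poissonExp, egf_sub ha.shift ha]
  ring

theorem poissonExp_add (ha : ExpGrowth a) (hb : ExpGrowth b) (x : ℝ) :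
    poissonExp (fun n => a n + b n) x = poissonExp a x + poissonExp b x := by
  rw [poissonExp, egf_add ha hb, mul_add]; rfl

theorem poissonExp_sub (ha : ExpGrowth a) (hb : ExpGrowth b) (x : ℝ) :
    poissonExp (fun n => a n - b n) x = poissonExp a x - poissonExp b x := by
  rw [poissonExp, egf_sub ha hb, mul_sub]; rfl

theorem poissonExp_const_mul (c x : ℝ) :
    poissonExp (fun n => c * a n) x = c * poissonExp a x := by
  rw [poissonExp, egf_const_mul, poissonExp]; ring

theorem poissonExp_pow (c x : ℝ) : poissonExp (fun n => c ^ n) x = Real.exp (x * (c - 1)) := by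
  rw [poissonExp, egf_pow, ← Real.exp_add]
  ring_nf

theorem poissonExp_const (c x : ℝ) : poissonExp (fun _ => c) x = c := by
  have := poissonExp_const_mul (a := fun n => 1 ^ n) c x
  rw [poissonExp_pow] at this
  simpa using this

theorem poissonExp_natCast_mul (ha : ExpGrowth a) (x : ℝ) :
    poissonExp (fun n => n * a n) x = x * poissonExp (fun n => a (n + 1)) x := by
  rw [poissonExp, egf_natCast_mul ha, poissonExp]; ring

theorem poissonExp_natCast (x : ℝ) : poissonExp (fun n => (n : ℝ)) x = x := by
  have := poissonExp_natCast_mul (ExpGrowth.const 1) x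
  simpa [poissonExp_const] using this

theorem poissonExp_mono (ha : ExpGrowth a) (hb : ExpGrowth b) {x : ℝ} (hx : 0 ≤ x)
    (h : ∀ n, a n ≤ b n) : poissonExp a x ≤ poissonExp b x := by
  refine mul_le_mul_of_nonneg_left ?_ (Real.exp_pos _).le
  exact (ha.summable x).tsum_le_tsum
    (fun n => mul_le_mul_of_nonneg_right (h n) (by positivity)) (hb.summable x)

theorem poissonExp_lt (ha : ExpGrowth a) (hb : ExpGrowth b) {x : ℝ} (hx : 0 ≤ x)
    (h : ∀ n, a n ≤ b n) (h0 : a 0 < b 0) : poissonExp a x < poissonExp b x := by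
  refine mul_lt_mul_of_pos_left ?_ (Real.exp_pos _)
  exact (ha.summable x).tsum_lt_tsum (i := 0)
    (fun n => mul_le_mul_of_nonneg_right (h n) (by positivity)) (by simpa using h0) (hb.summable x)

theorem poissonExp_zero (a : ℕ → ℝ) : poissonExp a 0 = a 0 := by
  rw [poissonExp, egf, tsum_eq_single 0]
  · simp
  · intro n hn; simp [hn]

theorem poissonExp_ite_zero (c x : ℝ) :
    poissonExp (fun n => if n = 0 then c else 0) x = Real.exp (-x) * c := by
  rw [poissonExp, egf, tsum_eq_single 0]
  · simp
  · intro n hn; simp [hn]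

theorem ExpGrowth.ite_zero (c : ℝ) : ExpGrowth fun n => if n = 0 then c else 0 :=
  (ExpGrowth.const c).of_le fun n => by split_ifs <;> simp

/-! ### Counting zeros -/

/-- Rolle's theorem for a finite set of points. -/
theorem exists_zeros_deriv {f f' : ℝ → ℝ} {m : ℕ} (z : Fin (m + 1) → ℝ) (hz : StrictMono z)
    (hf : ∀ x ∈ Set.Ioo (z 0) (z (Fin.last m)), HasDerivAt f (f' x) x)
    (hc : ContinuousOn f (Set.Icc (z 0) (z (Fin.last m)))) {c : ℝ} (h0 : ∀ j, f (z j) = c) :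
    ∃ w : Fin m → ℝ, StrictMono w ∧ ∀ j, w j ∈ Set.Ioo (z j.castSucc) (z j.succ) ∧ f' (w j) = 0 := by
  have h : ∀ j : Fin m, ∃ w ∈ Set.Ioo (z j.castSucc) (z j.succ), f' w = 0 := by
    intro j
    have hl : z 0 ≤ z j.castSucc := hz.monotone (Fin.zero_le _)
    have hr : z j.succ ≤ z (Fin.last m) := hz.monotone (Fin.le_last _)
    refine exists_hasDerivAt_eq_zero (hz (Fin.castSucc_lt_succ))
      (hc.mono (Set.Icc_subset_Icc hl hr)) (by rw [h0, h0]) fun x hx => hf x ?_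
    exact Set.Ioo_subset_Ioo hl hr hx
  choose w hw hw0 using h
  refine ⟨w, fun i j hij => ?_, fun j => ⟨hw j, hw0 j⟩⟩
  have : z i.succ ≤ z j.castSucc := hz.monotone (by simpa [Fin.le_def] using hij)
  exact (hw i).2.trans_le (this.trans (hw j).1.le)

theorem exists_finset_zeros_deriv {f f' : ℝ → ℝ} {l : ℝ}
    (hf : ∀ x, l < x → HasDerivAt f (f' x) x) (Z : Finset ℝ)
    (hZ : ∀ z ∈ Z, l < z ∧ f z = 0) :
    ∃ W : Finset ℝ, Z.card ≤ W.card + 1 ∧ ∀ w ∈ W, l < w ∧ f' w = 0 := by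
  rcases hm : Z.card with _ | m
  · exact ⟨∅, by simp, by simp⟩
  let z := Z.orderEmbOfFin hm
  have hl : ∀ j, l < z j := fun j => (hZ _ (Z.orderEmbOfFin_mem hm j)).1
  obtain ⟨w, hw, h⟩ := exists_zeros_deriv (f := f) (f' := f') (fun j => z j) z.strictMono
    (fun x hx => hf x ((hl 0).trans hx.1))
    (fun x hx => (hf x ((hl 0).trans_le hx.1)).continuousAt.continuousWithinAt)
    (c := 0) (fun j => (hZ _ (Z.orderEmbOfFin_mem hm j)).2)
  refine ⟨Finset.univ.map ⟨w, hw.injective⟩, by simp, fun x hx => ?_⟩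
  obtain ⟨j, -, rfl⟩ := Finset.mem_map.mp hx
  exact ⟨(hl _).trans (h j).1.1, (h j).2⟩

/-- Rolle applied to F(x)/x^j: up to a power of x its derivative is xF' - jF, whose coefficients are
(n - j)·a(n). One zero is lost and the coefficient of index j is erased. -/
theorem egf_zeros_euler (ha : ExpGrowth a) (j : ℕ) (Z : Finset ℝ)
    (hZ : ∀ z ∈ Z, 0 < z ∧ egf a z = 0) :
    ∃ W : Finset ℝ, Z.card ≤ W.card + 1 ∧
      ∀ w ∈ W, 0 < w ∧ egf (fun n => ((n : ℝ) - j) * a n) w = 0 := by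
  obtain ⟨W, hW, h⟩ := exists_finset_zeros_deriv (l := 0) (f := fun x => egf a x / x ^ j)
    (fun x hx => (egf_hasDerivAt ha x).div (hasDerivAt_pow j x) (by positivity)) Z
    (fun z hz => ⟨(hZ z hz).1, by simp [(hZ z hz).2]⟩)
  refine ⟨W, hW, fun w hw => ⟨(h w hw).1, ?_⟩⟩
  obtain ⟨h0, h1⟩ := h w hw
  have hj : (j : ℝ) * w ^ (j - 1) * w = j * w ^ j := by
    rcases j with _ | j
    · simp
    · simp [pow_succ, mul_assoc]
  rw [div_eq_zero_iff, or_iff_left (by positivity)] at h1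
  have h2 : egf (fun n => ((n : ℝ) - j) * a n) w = w * egf (fun n => a (n + 1)) w - j * egf a w := by
    rw [← egf_natCast_mul ha, ← egf_const_mul,
      ← egf_sub (ExpGrowth.natCast.mul ha) ((ExpGrowth.const _).mul ha)]
    simp only [sub_mul]
  have h3 : w ^ j * (w * egf (fun n => a (n + 1)) w - j * egf a w) = 0 := by
    linear_combination w * h1 + egf a w * hj
  rw [h2]
  exact (mul_eq_zero.mp h3).resolve_left (by positivity)

/-- A version of Descartes' rule of signs: an entire function whose Taylor coefficients are
nonnegative with at most `k` exceptions has at most `2 * k` positive zeros. -/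
theorem card_zeros_egf_le (S : Finset ℕ) : ∀ {a : ℕ → ℝ}, ExpGrowth a → (∀ n ∉ S, 0 ≤ a n) →
    {n | 0 < a n}.Infinite → ∀ Z : Finset ℝ, (∀ z ∈ Z, 0 < z ∧ egf a z = 0) →
    Z.card ≤ 2 * S.card := by
  induction S using Finset.induction_on with
  | empty =>
    intro a ha h0 hinf Z hZ
    obtain ⟨k, hk⟩ := hinf.nonempty
    rcases Z.eq_empty_or_nonempty with rfl | ⟨z, hz⟩
    · simp
    · exact absurd (hZ z hz).2 (egf_pos ha (hZ z hz).1 (fun n => h0 n (by simp)) hk).ne'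
  | insert j S hj ih =>
    intro a ha h0 hinf Z hZ
    -- The first Euler step erases the exceptional coefficient j but flips the signs below j; a
    -- second step at j + 1 restores them. Each exceptional index therefore costs two zeros.
    obtain ⟨W, hW, hW0⟩ := egf_zeros_euler ha j Z hZ
    have ha1 : ExpGrowth fun n => ((n : ℝ) - j) * a n :=
      (ExpGrowth.natCast.sub (ExpGrowth.const _)).mul ha
    obtain ⟨V, hV, hV0⟩ := egf_zeros_euler ha1 (j + 1) W hW0
    have ha2 : ExpGrowth fun n => ((n : ℝ) - (j + 1 : ℕ)) * (((n : ℝ) - j) * a n) :=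
      (ExpGrowth.natCast.sub (ExpGrowth.const _)).mul ha1
    -- No integer lies strictly between j and j + 1.
    have hsq : ∀ n : ℕ, 0 ≤ ((n : ℝ) - (j + 1 : ℕ)) * ((n : ℝ) - j) := by
      intro n
      rcases le_or_gt n j with h | h
      · have : (n : ℝ) ≤ j := by exact_mod_cast h
        push_cast
        nlinarith
      · have : (j : ℝ) + 1 ≤ n := by exact_mod_cast h
        push_cast
        nlinarith
    have := ih ha2 (fun n hn => ?_) ?_ V hV0
    · rw [Finset.card_insert_of_notMem hj]
      omega
    · rcases eq_or_ne n j with rfl | hnj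
      · simp
      · rw [← mul_assoc]
        exact mul_nonneg (hsq n) (h0 n (by simp [hnj, hn]))
    -- Only the coefficients j and j + 1 are erased, so infinitely many positive ones survive for
    -- the next round.
    · refine (hinf.sdiff (Set.toFinite {j, j + 1})).mono fun n hn => ?_
      obtain ⟨hn1, hn2⟩ := hn
      simp only [Set.mem_insert_iff, Set.mem_singleton_iff, not_or] at hn2
      have h1 : (n : ℝ) - j ≠ 0 := sub_ne_zero.mpr (by exact_mod_cast hn2.1)
      have h2 : (n : ℝ) - (j + 1 : ℕ) ≠ 0 := sub_ne_zero.mpr (by exact_mod_cast hn2.2)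
      simp only [Set.mem_ofPred_eq]
      rw [← mul_assoc]
      exact mul_pos (lt_of_le_of_ne (hsq n) (mul_ne_zero h2 h1).symm) hn1

end PoissonChannel

end

noncomputable section

namespace PoissonChannel

open Topology

/-! ### Moments of inputs -/

/-- The moment `∫ x ^ y * exp (-x)`, which is `y!` times the probability of the output `y`. -/
def mom (P : Measure ℝ) (y : ℕ) : ℝ := ∫ x, x ^ y * Real.exp (-x) ∂P

variable {A : ℝ} {P : Measure ℝ}

namespace IsInput

theorem nonneg (h : IsInput A P) : 0 ≤ A := by
  have := h.1
  obtain ⟨x, hx⟩ := h.2.exists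
  linarith

theorem mono (h : IsInput A P) {B : ℝ} (hAB : A ≤ B) : IsInput B P :=
  ⟨h.1, h.2.mono fun _ hx => ⟨hx.1, hx.2.trans hAB⟩⟩

theorem integrable (h : IsInput A P) {f : ℝ → ℝ} (hf : Continuous f) : Integrable f P := by
  have := h.1
  obtain ⟨C, hC⟩ := isCompact_Icc.exists_bound_of_continuousOn (s := Set.Icc 0 A) hf.continuousOn
  exact Integrable.of_bound hf.aestronglyMeasurable C (h.2.mono fun x hx => hC x hx)

theorem integral_mono (h : IsInput A P) {f g : ℝ → ℝ} (hf : Continuous f) (hg : Continuous g)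
    (hfg : ∀ x, 0 ≤ x → x ≤ A → f x ≤ g x) : ∫ x, f x ∂P ≤ ∫ x, g x ∂P :=
  integral_mono_ae (h.integrable hf) (h.integrable hg) (h.2.mono fun x hx => hfg x hx.1 hx.2)

end IsInput

theorem continuous_momFun (y : ℕ) : Continuous fun x : ℝ => x ^ y * Real.exp (-x) := by fun_prop

theorem mom_nonneg (h : IsInput A P) (y : ℕ) : 0 ≤ mom P y :=
  integral_nonneg_of_ae (h.2.mono fun _ hx => mul_nonneg (pow_nonneg hx.1 _) (Real.exp_pos _).le)

theorem mom_le (h : IsInput A P) (y : ℕ) : mom P y ≤ A ^ y := by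
  have := h.1
  have h1 := h.integral_mono (continuous_momFun y) (continuous_const (y := A ^ y)) fun x h0 hA => by
    calc x ^ y * Real.exp (-x) ≤ A ^ y * 1 := by
          gcongr
          · exact pow_nonneg (h0.trans hA) _
          · exact Real.exp_le_one_iff.mpr (by linarith)
      _ = _ := mul_one _
  simpa [mom] using h1

theorem mom_zero_pos (h : IsInput A P) : 0 < mom P 0 := by
  have := h.1
  have h1 := h.integral_mono (continuous_const (y := Real.exp (-A))) (continuous_momFun 0)
    fun _ h0 hA => by simpa using hA
  have h2 : Real.exp (-A) ≤ mom P 0 := by simpa [mom] using h1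
  exact (Real.exp_pos _).trans_le h2

theorem integral_pos_of_not_ae (h : IsInput A P) {f : ℝ → ℝ} (hf : Continuous f) {c : ℝ}
    (h0 : ∀ᵐ x ∂P, 0 ≤ f x) (hc : ∀ᵐ x ∂P, f x = 0 → x = c) (hP : ¬ ∀ᵐ x ∂P, x = c) :
    0 < ∫ x, f x ∂P := by
  refine lt_of_le_of_ne (integral_nonneg_of_ae h0) fun h1 => hP ?_
  have h2 := (integral_eq_zero_iff_of_nonneg_ae h0 (h.integrable hf)).mp h1.symm
  filter_upwards [h2, hc] with x hx hx' using hx' hx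

theorem mom_pos (h : IsInput A P) (hP : ¬ ∀ᵐ x ∂P, x = 0) (y : ℕ) : 0 < mom P y := by
  refine integral_pos_of_not_ae h (continuous_momFun y) ?_ ?_ hP
  · exact h.2.mono fun x hx => mul_nonneg (pow_nonneg hx.1 _) (Real.exp_pos _).le
  · refine ae_of_all _ fun x hx => ?_
    rcases mul_eq_zero.mp hx with h | h
    · by_contra hne
      exact pow_ne_zero y hne h
    · exact absurd h (Real.exp_pos _).ne'

theorem mom_succ_of_ae_eq_zero (hP : ∀ᵐ x ∂P, x = 0) (y : ℕ) : mom P (y + 1) = 0 := by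
  rw [mom, integral_congr_ae (g := fun _ => 0)]
  · simp
  · filter_upwards [hP] with x hx
    simp [hx]

/-- Cauchy-Schwarz for the weight x^y e^(-x), obtained from the nonnegative second moment about the
conditional mean c. -/
theorem mom_mul_mom_ge (h : IsInput A P) (hP : ¬ ∀ᵐ x ∂P, x = 0) (y : ℕ) :
    mom P (y + 1) ^ 2 ≤ mom P y * mom P (y + 2) := by
  set c := mom P (y + 1) / mom P y with hc
  have hpos := mom_pos h hP y
  have h1 : 0 ≤ ∫ x, (x - c) ^ 2 * (x ^ y * Real.exp (-x)) ∂P :=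
    integral_nonneg_of_ae (h.2.mono fun x hx =>
      mul_nonneg (sq_nonneg _) (mul_nonneg (pow_nonneg hx.1 _) (Real.exp_pos _).le))
  have h2 : ∫ x, (x - c) ^ 2 * (x ^ y * Real.exp (-x)) ∂P
      = mom P (y + 2) - 2 * c * mom P (y + 1) + c ^ 2 * mom P y := by
    have e : ∀ x : ℝ, (x - c) ^ 2 * (x ^ y * Real.exp (-x)) = x ^ (y + 2) * Real.exp (-x)
        - 2 * c * (x ^ (y + 1) * Real.exp (-x)) + c ^ 2 * (x ^ y * Real.exp (-x)) := fun x => by ring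
    simp only [e]
    have i := fun y => h.integrable (continuous_momFun y)
    have j := (i (y + 2)).sub ((i (y + 1)).const_mul (2 * c))
    simp only [Pi.sub_def] at j
    rw [integral_add j ((i _).const_mul _),
      integral_sub (i _) ((i _).const_mul _), integral_const_mul, integral_const_mul]
    rfl
  rw [h2] at h1
  have h3 : c * mom P y = mom P (y + 1) := by rw [hc]; field_simp
  nlinarith [mul_nonneg h1 hpos.le]

/-- The conditional mean of the input given the output `y`. -/
def condMean (P : Measure ℝ) (y : ℕ) : ℝ := mom P (y + 1) / mom P y

theorem condMean_pos (h : IsInput A P) (hP : ¬ ∀ᵐ x ∂P, x = 0) (y : ℕ) : 0 < condMean P y :=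
  div_pos (mom_pos h hP _) (mom_pos h hP _)

theorem condMean_mono (h : IsInput A P) (hP : ¬ ∀ᵐ x ∂P, x = 0) : Monotone (condMean P) := by
  refine monotone_nat_of_le_succ fun y => ?_
  rw [condMean, condMean, div_le_div_iff₀ (mom_pos h hP _) (mom_pos h hP _)]
  have := mom_mul_mom_ge h hP y
  nlinarith

theorem mom_succ_sub (h : IsInput A P) (c : ℝ) (y : ℕ) :
    mom P (y + 1) - c * mom P y = ∫ x, (x - c) * (x ^ y * Real.exp (-x)) ∂P := by
  have e : ∀ x : ℝ, (x - c) * (x ^ y * Real.exp (-x)) = x ^ (y + 1) * Real.exp (-x)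
        - c * (x ^ y * Real.exp (-x)) := fun x => by ring
  simp only [e]
  have i := fun y => h.integrable (continuous_momFun y)
  rw [integral_sub (i _) ((i _).const_mul _), integral_const_mul]
  rfl

theorem condMean_le_of_ae (h : IsInput A P) (hP : ¬ ∀ᵐ x ∂P, x = 0) {b : ℝ}
    (hb : ∀ᵐ x ∂P, x ≤ b) (y : ℕ) : condMean P y ≤ b := by
  rw [condMean, div_le_iff₀ (mom_pos h hP _), ← sub_nonpos, mom_succ_sub h]
  refine integral_nonpos_of_ae ?_
  filter_upwards [h.2, hb] with x hx hxb
  exact mul_nonpos_of_nonpos_of_nonneg (by linarith)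
    (mul_nonneg (pow_nonneg hx.1 _) (Real.exp_pos _).le)

theorem le_condMean_of_ae (h : IsInput A P) (hP : ¬ ∀ᵐ x ∂P, x = 0) {b : ℝ}
    (hb : ∀ᵐ x ∂P, b ≤ x) (y : ℕ) : b ≤ condMean P y := by
  rw [condMean, le_div_iff₀ (mom_pos h hP _), ← sub_nonneg, mom_succ_sub h]
  refine integral_nonneg_of_ae ?_
  filter_upwards [h.2, hb] with x hx hxb
  exact mul_nonneg (by linarith) (mul_nonneg (pow_nonneg hx.1 _) (Real.exp_pos _).le)

theorem condMean_zero_lt (h : IsInput A P) (hP : ¬ ∀ᵐ x ∂P, x = 0) {b : ℝ}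
    (hb : ∀ᵐ x ∂P, x ≤ b) (hb' : ¬ ∀ᵐ x ∂P, x = b) : condMean P 0 < b := by
  rw [condMean, div_lt_iff₀ (mom_pos h hP _), ← sub_neg, mom_succ_sub h, ← neg_pos,
    ← integral_neg]
  refine integral_pos_of_not_ae h (by fun_prop) (hb.mono fun x hx => ?_)
    (ae_of_all _ fun x hx => ?_) hb'
  · rw [← neg_mul]
    exact mul_nonneg (by linarith) (by positivity)
  · have : x - b = 0 := by simpa using hx
    linarith

theorem lt_condMean_zero (h : IsInput A P) (hP : ¬ ∀ᵐ x ∂P, x = 0) {b : ℝ}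
    (hb : ∀ᵐ x ∂P, b ≤ x) (hb' : ¬ ∀ᵐ x ∂P, x = b) : b < condMean P 0 := by
  rw [condMean, lt_div_iff₀ (mom_pos h hP _), ← sub_pos, mom_succ_sub h]
  refine integral_pos_of_not_ae h (by fun_prop) (hb.mono fun x hx => ?_)
    (ae_of_all _ fun x hx => ?_) hb'
  · exact mul_nonneg (by linarith) (by positivity)
  · have : x - b = 0 := by simpa using hx
    linarith

theorem condMean_le (h : IsInput A P) (hP : ¬ ∀ᵐ x ∂P, x = 0) (y : ℕ) : condMean P y ≤ A :=
  condMean_le_of_ae h hP (h.2.mono fun _ hx => hx.2) y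

theorem log_condMean_eq (h : IsInput A P) (hP : ¬ ∀ᵐ x ∂P, x = 0) (y : ℕ) :
    Real.log (condMean P y) = Real.log (mom P (y + 1)) - Real.log (mom P y) :=
  Real.log_div (mom_pos h hP _).ne' (mom_pos h hP _).ne'

theorem expGrowth_log_condMean (h : IsInput A P) (hP : ¬ ∀ᵐ x ∂P, x = 0) :
    ExpGrowth fun y => Real.log (condMean P y) := by
  refine (ExpGrowth.const (|Real.log (condMean P 0)| + |Real.log A|)).of_le fun y => ?_
  have h0 := condMean_pos h hP 0
  have h1 := Real.log_le_log h0 (condMean_mono h hP (Nat.zero_le y))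
  have h2 := Real.log_le_log (condMean_pos h hP y) (condMean_le h hP y)
  have h3 := neg_abs_le (Real.log (condMean P 0))
  have h4 := le_abs_self (Real.log A)
  rw [abs_of_nonneg (a := |Real.log (condMean P 0)| + |Real.log A|) (by positivity), abs_le]
  constructor <;> linarith [abs_nonneg (Real.log A), abs_nonneg (Real.log (condMean P 0))]

/-- The increments are log conditional means, confined between the value at output 0 and log A, so
the growth is linear. For the point mass at 0 the convention log 0 = 0 makes all later terms vanish.
-/
theorem expGrowth_log_mom (h : IsInput A P) : ExpGrowth fun y => Real.log (mom P y) := by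
  by_cases hP : ∀ᵐ x ∂P, x = 0
  · refine ExpGrowth.unshift ((ExpGrowth.const 0).of_le fun n => ?_)
    simp [mom_succ_of_ae_eq_zero hP]
  · set K := |Real.log (mom P 0)| + |Real.log (condMean P 0)| + |Real.log A| with hK
    refine ((ExpGrowth.const K).mul
      (ExpGrowth.natCast.add (ExpGrowth.const 1))).of_le fun y => ?_
    have key : |Real.log (mom P y)| ≤ K * (y + 1) := by
      induction y with
      | zero =>
        have := abs_nonneg (Real.log (condMean P 0))
        have := abs_nonneg (Real.log A)
        simp; linarith
      | succ y ih =>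
        have h0 := condMean_pos h hP 0
        have h1 := Real.log_le_log h0 (condMean_mono h hP (Nat.zero_le y))
        have h2 := Real.log_le_log (condMean_pos h hP y) (condMean_le h hP y)
        rw [log_condMean_eq h hP y] at h1 h2
        have h3 := neg_abs_le (Real.log (condMean P 0))
        have h4 := le_abs_self (Real.log A)
        have h5 := abs_nonneg (Real.log (mom P 0))
        have h6 := abs_nonneg (Real.log (condMean P 0))
        have h7 := abs_nonneg (Real.log A)
        push_cast
        rw [abs_le] at ih ⊢
        constructor <;> nlinarith
    exact key.trans (le_abs_self _)

theorem summable_mul_mom (h : IsInput A P) {a : ℕ → ℝ} (ha : ExpGrowth a) :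
    Summable fun y : ℕ => a y * (mom P y / (y.factorial : ℝ)) := by
  refine Summable.of_norm_bounded (ha.abs.summable A) fun y => ?_
  rw [Real.norm_eq_abs, abs_mul, abs_div, Nat.abs_cast, abs_of_nonneg (mom_nonneg h y)]
  gcongr
  exact mom_le h y

theorem integral_poissonExp (h : IsInput A P) {a : ℕ → ℝ} (ha : ExpGrowth a) :
    ∫ x, poissonExp a x ∂P = ∑' y : ℕ, a y * (mom P y / (y.factorial : ℝ)) := by
  have h1 := hasSum_integral_of_summable_integral_norm (μ := P)
    (F := fun (y : ℕ) (x : ℝ) => a y / (y.factorial : ℝ) * (x ^ y * Real.exp (-x)))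
    (fun y => (h.integrable (continuous_momFun y)).const_mul _) ?_
  · rw [show (fun x => poissonExp a x) = fun x => ∑' y : ℕ, a y / (y.factorial : ℝ) *
      (x ^ y * Real.exp (-x)) from ?_, ← h1.tsum_eq]
    · congr 1
      ext y
      rw [integral_const_mul, mom]
      ring
    · ext x
      rw [poissonExp, egf, ← tsum_mul_left]
      congr 1
      ext y
      ring
  · refine (summable_mul_mom h ha.abs).congr fun y => ?_
    rw [← mul_div_assoc, mul_div_right_comm, mom, ← integral_const_mul]
    refine integral_congr_ae (h.2.mono fun x hx => ?_)
    dsimp only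
    rw [norm_mul, norm_div, Real.norm_natCast, Real.norm_eq_abs, Real.norm_eq_abs (x ^ y * _),
      abs_of_nonneg (mul_nonneg (pow_nonneg hx.1 _) (Real.exp_pos _).le)]

theorem hasSum_mom (h : IsInput A P) : HasSum (fun y : ℕ => mom P y / (y.factorial : ℝ)) 1 := by
  have := h.1
  have h1 := summable_mul_mom h (ExpGrowth.const 1)
  have h2 := integral_poissonExp h (ExpGrowth.const 1)
  simp only [poissonExp_const, one_mul, integral_const, probReal_univ, smul_eq_mul] at h1 h2
  rw [h2]
  exact h1.hasSum

/-! ### The information density -/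

/-- The relative entropy of the Poisson law with mean `x` with respect to the law on `ℕ` with
probabilities `m y / y!`. -/
def infoDensity (m : ℕ → ℝ) (x : ℝ) : ℝ :=
  x * Real.log x - x - poissonExp (fun y => Real.log (m y)) x

/-- The mutual information as an integral of the information density. -/
def info (P : Measure ℝ) : ℝ := ∫ x, infoDensity (mom P) x ∂P

theorem continuous_infoDensity {m : ℕ → ℝ} (hm : ExpGrowth fun y => Real.log (m y)) :
    Continuous (infoDensity m) :=
  (Real.continuous_mul_log.sub continuous_id).sub (poissonExp_continuous hm)

/-- Gibbs' inequality: replacing the true output law by any other reference law increases the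
average divergence. It serves both the Kuhn-Tucker conditions and the upper bound on capacity. -/
theorem info_le_integral (h : IsInput A P) {m : ℕ → ℝ} (hm : ExpGrowth fun y => Real.log (m y))
    (hpos : ∀ y, 0 < m y) (hsum : HasSum (fun y : ℕ => m y / (y.factorial : ℝ)) 1) :
    info P ≤ ∫ x, infoDensity m x ∂P := by
  have hP := expGrowth_log_mom h
  have i0 : Integrable (fun x : ℝ => x * Real.log x - x) P :=
    h.integrable (Real.continuous_mul_log.sub continuous_id)
  simp only [info, infoDensity]
  rw [integral_sub i0 (h.integrable (poissonExp_continuous hP)),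
    integral_sub i0 (h.integrable (poissonExp_continuous hm)),
    integral_poissonExp h hP, integral_poissonExp h hm]
  have h1 : ∑' y : ℕ, Real.log (m y) * (mom P y / (y.factorial : ℝ))
      ≤ ∑' y : ℕ, (Real.log (mom P y) * (mom P y / (y.factorial : ℝ)) +
        (m y / (y.factorial : ℝ) - mom P y / (y.factorial : ℝ))) := by
    refine (summable_mul_mom h hm).tsum_le_tsum (fun y => ?_)
      ((summable_mul_mom h hP).add (hsum.summable.sub (hasSum_mom h).summable))
    have key : Real.log (m y) * mom P y ≤ Real.log (mom P y) * mom P y + (m y - mom P y) := by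
      rcases (mom_nonneg h y).eq_or_lt with h0 | h0
      · rw [← h0]; simp [(hpos y).le]
      · have h2 := Real.log_le_sub_one_of_pos (div_pos (hpos y) h0)
        rw [Real.log_div (hpos y).ne' h0.ne', le_sub_iff_add_le, le_div_iff₀ h0] at h2
        linarith
    have h3 : (0 : ℝ) < y.factorial := by positivity
    rw [← mul_div_assoc, ← mul_div_assoc, ← sub_div, ← add_div]
    exact div_le_div_of_nonneg_right key h3.le
  rw [(summable_mul_mom h hP).tsum_add (hsum.summable.sub (hasSum_mom h).summable),
    hsum.summable.tsum_sub (hasSum_mom h).summable, hsum.tsum_eq, (hasSum_mom h).tsum_eq] at h1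
  linarith

end PoissonChannel

end

noncomputable section

namespace PoissonChannel

open Topology

/-! ### Mutual information as an integral -/

variable {A : ℝ} {P : Measure ℝ}

theorem integral_channel {x : ℝ} (hx : 0 ≤ x) (f : ℕ → ℝ) :
    ∫ y, f y ∂(channel x) = poissonExp f x := by
  change ∫ y, f y ∂(poissonMeasure x.toNNReal) = _
  rw [integral_poissonMeasure, Real.coe_toNNReal x hx, poissonExp, egf, ← tsum_mul_left]
  congr 1
  ext n
  rw [smul_eq_mul]
  ring

theorem integrable_channel {x : ℝ} (hx : 0 ≤ x) {f : ℕ → ℝ} (hf : ExpGrowth f) :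
    Integrable f (channel x) := by
  change Integrable f (poissonMeasure x.toNNReal)
  rw [integrable_poissonMeasure_iff, Real.coe_toNNReal x hx]
  refine ((hf.abs.summable x).mul_left (Real.exp (-x))).congr fun n => ?_
  rw [Real.norm_eq_abs]
  ring

theorem channel_singleton {x : ℝ} (hx : 0 ≤ x) (y : ℕ) :
    channel x {y} = ENNReal.ofReal (x ^ y * Real.exp (-x) / (y.factorial : ℝ)) := by
  rw [← ofReal_measureReal, channel_real_singleton hx]
  ring_nf

theorem outputLaw_singleton (h : IsInput A P) (y : ℕ) :
    outputLaw P {y} = ENNReal.ofReal (mom P y / (y.factorial : ℝ)) := by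
  rw [outputLaw, Measure.bind_apply (by measurability) channel.aemeasurable, mom, ← integral_div,
    ofReal_integral_eq_lintegral_ofReal ((h.integrable (continuous_momFun y)).div_const _)
      (h.2.mono fun x hx => div_nonneg (mul_nonneg (pow_nonneg hx.1 _) (Real.exp_pos _).le)
        (by positivity))]
  exact lintegral_congr_ae (h.2.mono fun x hx => channel_singleton hx.1 y)

theorem outputLaw_real_singleton (h : IsInput A P) (y : ℕ) :
    (outputLaw P).real {y} = mom P y / (y.factorial : ℝ) := by
  rw [measureReal_def, outputLaw_singleton h, ENNReal.toReal_ofReal]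
  exact div_nonneg (mom_nonneg h y) (by positivity)

theorem isProbabilityMeasure_outputLaw (h : IsInput A P) : IsProbabilityMeasure (outputLaw P) := by
  have := h.1
  unfold outputLaw
  infer_instance

/-- The density of the joint law with respect to the product of its marginals. -/
def jointDensity (P : Measure ℝ) (z : ℝ × ℕ) : ℝ := z.1 ^ z.2 * Real.exp (-z.1) / mom P z.2

theorem measurable_jointDensity (P : Measure ℝ) : Measurable (jointDensity P) := by
  refine measurable_from_prod_countable_left fun y => ?_
  simp only [jointDensity]
  fun_prop

theorem ae_eq_zero_of_mom_eq_zero (h : IsInput A P) {y : ℕ} (hy : mom P y = 0) :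
    ∀ᵐ x ∂P, x ^ y * Real.exp (-x) = 0 :=
  (integral_eq_zero_iff_of_nonneg_ae (h.2.mono fun _ hx =>
    mul_nonneg (pow_nonneg hx.1 _) (Real.exp_pos _).le) (h.integrable (continuous_momFun y))).mp hy

theorem compProd_eq_withDensity (h : IsInput A P) :
    P.compProd channel =
      (P.prod (outputLaw P)).withDensity fun z => ENNReal.ofReal (jointDensity P z) := by
  have := h.1
  have := isProbabilityMeasure_outputLaw h
  ext s hs
  have hm : Measurable fun z => ENNReal.ofReal (jointDensity P z) :=
    (measurable_jointDensity P).ennreal_ofReal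
  rw [Measure.compProd_apply hs, withDensity_apply _ hs, ← lintegral_indicator hs,
    lintegral_prod _ (hm.indicator hs).aemeasurable]
  -- Where `mom P y` vanishes the density is 0 by the division convention; this is harmless because
  -- the numerator vanishes almost surely there.
  have h0 : ∀ᵐ x ∂P, ∀ y, mom P y = 0 → x ^ y * Real.exp (-x) = 0 := by
    rw [ae_all_iff]
    intro y
    by_cases hy : mom P y = 0
    · exact (ae_eq_zero_of_mom_eq_zero h hy).mono fun x hx _ => hx
    · exact ae_of_all _ fun x hx => absurd hx hy
  refine lintegral_congr_ae ?_
  filter_upwards [h.2, h0] with x hx hx0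
  rw [← lintegral_indicator_one (measurable_prodMk_left hs), lintegral_countable',
    lintegral_countable']
  congr 1
  ext y
  rw [channel_singleton hx.1, outputLaw_singleton h]
  by_cases hxy : (x, y) ∈ s
  · rw [Set.indicator_of_mem hxy, Set.indicator_of_mem (by simpa using hxy), Pi.one_apply, one_mul,
      ← ENNReal.ofReal_mul]
    · congr 1
      by_cases hy : mom P y = 0
      · simp [hx0 y hy, hy]
      · simp only [jointDensity]
        field_simp
    · exact div_nonneg (mul_nonneg (pow_nonneg hx.1 _) (Real.exp_pos _).le) (mom_nonneg h y)
  · rw [Set.indicator_of_notMem hxy, Set.indicator_of_notMem (by simpa using hxy)]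
    simp

/-- At x = 0 only the output 0 occurs, so vanishing moments of higher order are never seen; this is
why positivity is required only for x ≠ 0. -/
theorem integral_log_jointDensity {x : ℝ} (hx : 0 ≤ x) (h : IsInput A P)
    (hpos : x ≠ 0 → ∀ y, mom P y ≠ 0) :
    ∫ y, Real.log (jointDensity P (x, y)) ∂(channel x) = infoDensity (mom P) x := by
  have hP := expGrowth_log_mom h
  rw [integral_channel hx]
  rcases eq_or_ne x 0 with rfl | h0
  · simp [poissonExp_zero, infoDensity, jointDensity]
  have e : (fun y => Real.log (jointDensity P (x, y)))
      = fun y : ℕ => (Real.log x * y - x) - Real.log (mom P y) := by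
    ext y
    simp only [jointDensity]
    rw [Real.log_div (by positivity) (hpos h0 y), Real.log_mul (by positivity) (by positivity),
      Real.log_pow, Real.log_exp]
    ring
  have g1 : ExpGrowth fun y : ℕ => Real.log x * y := (ExpGrowth.const _).mul ExpGrowth.natCast
  rw [e, poissonExp_sub (g1.sub (ExpGrowth.const x)) hP, poissonExp_sub g1 (ExpGrowth.const x),
    poissonExp_const_mul, poissonExp_natCast, poissonExp_const, infoDensity]
  ring

theorem abs_log_jointDensity_le (P : Measure ℝ) {x : ℝ} (hx : 0 ≤ x) (y : ℕ) :
    |Real.log (jointDensity P (x, y))| ≤ (|Real.log x| * y + x) + |Real.log (mom P y)| := by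
  by_cases h0 : x ^ y * Real.exp (-x) = 0
  · simp only [jointDensity, h0, zero_div, Real.log_zero, abs_zero]
    positivity
  by_cases hy : mom P y = 0
  · simp only [jointDensity, hy, div_zero, Real.log_zero, abs_zero]
    positivity
  simp only [jointDensity]
  rw [Real.log_div h0 hy, Real.log_mul (left_ne_zero_of_mul h0) (right_ne_zero_of_mul h0),
    Real.log_pow, Real.log_exp]
  refine (abs_sub _ _).trans (add_le_add_left ((abs_add_le _ _).trans ?_) _)
  rw [abs_mul, abs_neg, abs_of_nonneg hx, Nat.abs_cast, mul_comm]

theorem integrable_log_jointDensity (h : IsInput A P) :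
    Integrable (fun z => Real.log (jointDensity P z)) (P.compProd channel) := by
  have := h.1
  have hm : Measurable fun z => Real.log (jointDensity P z) := (measurable_jointDensity P).log
  have hP := (expGrowth_log_mom h).abs
  have g : ∀ x : ℝ, ExpGrowth fun y : ℕ => (|Real.log x| * y + x) := fun x =>
    ((ExpGrowth.const _).mul ExpGrowth.natCast).add (ExpGrowth.const x)
  have g' : ∀ x : ℝ, 0 ≤ x → ExpGrowth fun y : ℕ => Real.log (jointDensity P (x, y)) := fun x hx =>
    ((g x).add hP).of_le fun y => (abs_log_jointDensity_le P hx y).trans (le_abs_self _)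
  rw [Measure.integrable_compProd_iff hm.aestronglyMeasurable]
  refine ⟨h.2.mono fun x hx => integrable_channel hx.1 (g' x hx.1), ?_⟩
  have i1 : Integrable (fun x => |x * Real.log x| + x
      + poissonExp (fun y => |Real.log (mom P y)|) x) P :=
    h.integrable (((Real.continuous_mul_log.abs).add continuous_id).add (poissonExp_continuous hP))
  refine i1.mono' ?_ (h.2.mono fun x hx => ?_)
  · exact (hm.norm.stronglyMeasurable.integral_kernel_prod_right' (κ := channel)).aestronglyMeasurable
  · rw [Real.norm_of_nonneg (integral_nonneg fun _ => norm_nonneg _), integral_channel hx.1]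
    calc poissonExp (fun y => ‖Real.log (jointDensity P (x, y))‖) x
        ≤ poissonExp (fun y => (|Real.log x| * y + x) + |Real.log (mom P y)|) x :=
          poissonExp_mono (g' x hx.1).abs ((g x).add hP) hx.1
            fun y => abs_log_jointDensity_le P hx.1 y
      _ = _ := by
          rw [poissonExp_add (g x) hP, poissonExp_add ((ExpGrowth.const _).mul ExpGrowth.natCast)
            (ExpGrowth.const x), poissonExp_const_mul, poissonExp_natCast, poissonExp_const, abs_mul,
            abs_of_nonneg hx.1, mul_comm]

theorem mutualInfo_ne_top_and_toReal (h : IsInput A P) :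
    mutualInfo P ≠ ∞ ∧ (mutualInfo P).toReal = info P := by
  have := h.1
  have := isProbabilityMeasure_outputLaw h
  have hac : P.compProd channel ≪ P.prod (outputLaw P) := by
    rw [compProd_eq_withDensity h]
    exact withDensity_absolutelyContinuous _ _
  have hm : Measurable fun z => ENNReal.ofReal (jointDensity P z) :=
    (measurable_jointDensity P).ennreal_ofReal
  have hae : ∀ᵐ z ∂(P.compProd channel), 0 ≤ z.1 := by
    rw [Measure.ae_compProd_iff (measurableSet_le measurable_const measurable_fst)]
    exact h.2.mono fun x hx => ae_of_all _ fun _ => hx.1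
  have hllr : llr (P.compProd channel) (P.prod (outputLaw P))
      =ᵐ[P.compProd channel] fun z => Real.log (jointDensity P z) := by
    have h1 : (P.compProd channel).rnDeriv (P.prod (outputLaw P))
        =ᵐ[P.prod (outputLaw P)] fun z => ENNReal.ofReal (jointDensity P z) := by
      conv_lhs => rw [compProd_eq_withDensity h]
      exact Measure.rnDeriv_withDensity _ hm
    filter_upwards [hac.ae_le h1, hae] with z hz hz0
    rw [llr, hz, ENNReal.toReal_ofReal]
    exact div_nonneg (mul_nonneg (pow_nonneg hz0 _) (Real.exp_pos _).le) (mom_nonneg h _)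
  have hint : Integrable (llr (P.compProd channel) (P.prod (outputLaw P))) (P.compProd channel) :=
    (integrable_log_jointDensity h).congr hllr.symm
  refine ⟨InformationTheory.klDiv_ne_top hac hint, ?_⟩
  rw [mutualInfo, InformationTheory.toReal_klDiv_of_measure_eq hac (by simp),
    integral_congr_ae hllr, Measure.integral_compProd (integrable_log_jointDensity h), info]
  have h0 : ∀ᵐ x ∂P, x ≠ 0 → ∀ y, mom P y ≠ 0 := by
    by_cases hP : ∀ᵐ x ∂P, x = 0
    · exact hP.mono fun x hx hx' => absurd hx hx'
    · exact ae_of_all _ fun x _ y => (mom_pos h hP y).ne'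
  refine integral_congr_ae ?_
  filter_upwards [h.2, h0] with x hx hx0
  exact integral_log_jointDensity hx.1 h hx0

theorem info_nonneg (h : IsInput A P) : 0 ≤ info P :=
  (mutualInfo_ne_top_and_toReal h).2 ▸ ENNReal.toReal_nonneg

theorem mutualInfo_eq_ofReal (h : IsInput A P) : mutualInfo P = ENNReal.ofReal (info P) := by
  rw [← (mutualInfo_ne_top_and_toReal h).2, ENNReal.ofReal_toReal (mutualInfo_ne_top_and_toReal h).1]

end PoissonChannel

end

noncomputable section

namespace PoissonChannel

open Topology

/-! ### Existence of capacity-achieving inputs -/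

variable {A : ℝ} {P : Measure ℝ}

theorem info_eq (h : IsInput A P) : info P = ∫ x, (x * Real.log x - x) ∂P +
    ∑' y : ℕ, Real.negMulLog (mom P y) / (y.factorial : ℝ) := by
  have hP := expGrowth_log_mom h
  have e : ∀ y : ℕ, Real.negMulLog (mom P y) / (y.factorial : ℝ)
      = -(Real.log (mom P y) * (mom P y / (y.factorial : ℝ))) := fun y => by
    rw [Real.negMulLog]; ring
  simp only [info, infoDensity]
  have i0 : Integrable (fun x : ℝ => x * Real.log x - x) P :=
    h.integrable (Real.continuous_mul_log.sub continuous_id)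
  rw [integral_sub i0 (h.integrable (poissonExp_continuous hP)), integral_poissonExp h hP]
  simp only [e, tsum_neg, sub_eq_add_neg]

theorem abs_negMulLog_le {t : ℝ} (ht : 0 ≤ t) : |Real.negMulLog t| ≤ 1 + t ^ 2 := by
  rcases ht.eq_or_lt with rfl | ht
  · simp
  have h1 := Real.log_le_sub_one_of_pos ht
  have h2 := Real.one_sub_inv_le_log_of_pos ht
  have h3 : t * (1 - t⁻¹) = t - 1 := by field_simp
  have h4 := mul_le_mul_of_nonneg_left h2 ht.le
  rw [Real.negMulLog, abs_le]
  constructor <;> nlinarith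

/-- The input law on `ℝ` given by a probability measure on `[0, A]`. -/
def inputOf (μ : ProbabilityMeasure (Set.Icc 0 A)) : Measure ℝ := (μ : Measure (Set.Icc 0 A)).map Subtype.val

theorem isInput_inputOf (μ : ProbabilityMeasure (Set.Icc 0 A)) : IsInput A (inputOf μ) := by
  refine ⟨Measure.isProbabilityMeasure_map measurable_subtype_coe.aemeasurable, ?_⟩
  rw [inputOf, ae_map_iff measurable_subtype_coe.aemeasurable (by measurability)]
  exact ae_of_all _ fun x => x.2

theorem exists_inputOf_eq (h : IsInput A P) :
    ∃ μ : ProbabilityMeasure (Set.Icc 0 A), inputOf μ = P := by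
  have h1 : (P.comap ((↑) : Set.Icc 0 A → ℝ)).map (↑) = P := by
    rw [map_comap_subtype_coe measurableSet_Icc, Measure.restrict_eq_self_of_ae_mem]
    exact h.2
  have := h.1
  refine ⟨⟨P.comap ((↑) : Set.Icc 0 A → ℝ), ⟨?_⟩⟩, h1⟩
  rw [← Set.preimage_univ (f := ((↑) : Set.Icc 0 A → ℝ)),
    ← Measure.map_apply measurable_subtype_coe MeasurableSet.univ, h1, measure_univ]

theorem continuous_integral_inputOf {f : ℝ → ℝ} (hf : Continuous f) :
    Continuous fun μ : ProbabilityMeasure (Set.Icc 0 A) => ∫ x, f x ∂(inputOf μ) := by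
  have h := ProbabilityMeasure.continuous_integral_boundedContinuousFunction
    (BoundedContinuousFunction.mkOfCompact
      ⟨fun x : Set.Icc 0 A => f x, hf.comp continuous_subtype_val⟩)
  refine h.congr fun μ => ?_
  rw [inputOf, integral_map measurable_subtype_coe.aemeasurable hf.aestronglyMeasurable]
  rfl

/-- By `info_eq` the information is a continuous linear functional plus a series of -t log t at the
moments. The bounds 1 + t² and t ≤ A^y make the series converge uniformly. -/
theorem continuous_info_inputOf :
    Continuous fun μ : ProbabilityMeasure (Set.Icc 0 A) => info (inputOf μ) := by
  have e := fun μ : ProbabilityMeasure (Set.Icc 0 A) => info_eq (isInput_inputOf μ)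
  simp only [e]
  refine (continuous_integral_inputOf (Real.continuous_mul_log.sub continuous_id)).add ?_
  refine continuous_tsum (u := fun y : ℕ => 1 * (1 ^ y / (y.factorial : ℝ)) +
    (A ^ 2) ^ y / (y.factorial : ℝ)) (fun y => ?_) ?_ fun y μ => ?_
  · exact (Real.continuous_negMulLog.comp
      (continuous_integral_inputOf (continuous_momFun y))).div_const _
  · exact ((ExpGrowth.const 1).summable 1).add (Real.summable_pow_div_factorial _)
  · have h := isInput_inputOf μ
    rw [Real.norm_eq_abs, abs_div, Nat.abs_cast, one_mul, one_pow, ← add_div]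
    gcongr
    refine (abs_negMulLog_le (mom_nonneg h y)).trans ?_
    rw [← pow_mul, mul_comm, pow_mul]
    gcongr
    · exact mom_nonneg h y
    · exact mom_le h y

theorem isInput_dirac {x : ℝ} (h0 : 0 ≤ x) (hA : x ≤ A) : IsInput A (Measure.dirac x) :=
  ⟨inferInstance, by rw [ae_dirac_eq]; exact ⟨h0, hA⟩⟩

theorem exists_isMax_info (hA : 0 ≤ A) :
    ∃ P, IsInput A P ∧ ∀ Q, IsInput A Q → info Q ≤ info P := by
  obtain ⟨μ₀, -⟩ := exists_inputOf_eq (isInput_dirac le_rfl hA)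
  obtain ⟨μ, -, hμ⟩ := isCompact_univ.exists_isMaxOn ⟨μ₀, Set.mem_univ _⟩
    (continuous_info_inputOf (A := A)).continuousOn
  refine ⟨inputOf μ, isInput_inputOf μ, fun Q hQ => ?_⟩
  obtain ⟨ν, rfl⟩ := exists_inputOf_eq hQ
  exact hμ (Set.mem_univ ν)

theorem capacityENN_eq_of_isMax (h : IsInput A P) (hmax : ∀ Q, IsInput A Q → info Q ≤ info P) :
    capacityENN A = ENNReal.ofReal (info P) := by
  refine le_antisymm (iSup₂_le fun Q hQ => ?_) ?_
  · rw [mutualInfo_eq_ofReal hQ]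
    exact ENNReal.ofReal_le_ofReal (hmax Q hQ)
  · rw [← mutualInfo_eq_ofReal h]
    exact le_iSup₂ (f := fun (P : Measure ℝ) (_ : IsInput A P) => mutualInfo P) P h

theorem capacityENN_ne_top (hA : 0 ≤ A) : capacityENN A ≠ ∞ := by
  obtain ⟨P, h, hmax⟩ := exists_isMax_info hA
  rw [capacityENN_eq_of_isMax h hmax]
  exact ENNReal.ofReal_ne_top

theorem exists_isCapacityAchieving (hA : 0 ≤ A) : ∃ P, IsCapacityAchieving A P := by
  obtain ⟨P, h, hmax⟩ := exists_isMax_info hA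
  exact ⟨P, h, by rw [capacityENN_eq_of_isMax h hmax, mutualInfo_eq_ofReal h]⟩

theorem info_le_capacity (h : IsInput A P) : info P ≤ capacity A := by
  obtain ⟨Q, hQ, hmax⟩ := exists_isMax_info h.nonneg
  rw [capacity, capacityENN_eq_of_isMax hQ hmax, ENNReal.toReal_ofReal (info_nonneg hQ)]
  exact hmax P h

theorem capacity_nonneg (A : ℝ) : 0 ≤ capacity A := ENNReal.toReal_nonneg

theorem IsCapacityAchieving.info_eq (h : IsCapacityAchieving A P) : info P = capacity A := by
  rw [capacity, ← h.2, (mutualInfo_ne_top_and_toReal h.1).2]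

/-! ### The optimality conditions -/

/-- The mixture of an input law with a point mass. -/
def mixDirac (P : Measure ℝ) (t x : ℝ) : Measure ℝ :=
  ENNReal.ofReal (1 - t) • P + ENNReal.ofReal t • Measure.dirac x

theorem isInput_mixDirac (h : IsInput A P) {t x : ℝ} (ht : 0 ≤ t) (ht1 : t ≤ 1) (h0 : 0 ≤ x)
    (hA : x ≤ A) : IsInput A (mixDirac P t x) := by
  have := h.1
  constructor
  · constructor
    rw [mixDirac, Measure.add_apply, Measure.smul_apply, Measure.smul_apply, measure_univ,
      measure_univ, smul_eq_mul, smul_eq_mul, mul_one, mul_one,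
      ← ENNReal.ofReal_add (by linarith) ht]
    simp
  · rw [mixDirac, ae_add_measure_iff]
    refine ⟨Measure.ae_smul_measure h.2 _, Measure.ae_smul_measure ?_ _⟩
    rw [ae_dirac_eq]
    exact ⟨h0, hA⟩

theorem integral_mixDirac (h : IsInput A P) {t : ℝ} (x : ℝ) (ht : 0 ≤ t) (ht1 : t ≤ 1) {f : ℝ → ℝ}
    (hf : Continuous f) : ∫ z, f z ∂(mixDirac P t x) = (1 - t) * ∫ z, f z ∂P + t * f x := by
  rw [mixDirac, integral_add_measure ((h.integrable hf).smul_measure ENNReal.ofReal_ne_top)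
    ((integrable_dirac (by simp)).smul_measure ENNReal.ofReal_ne_top), integral_smul_measure,
    integral_smul_measure, integral_dirac, ENNReal.toReal_ofReal (by linarith),
    ENNReal.toReal_ofReal ht, smul_eq_mul, smul_eq_mul]

/-- Integrating the mixture's own density j against the mixture gives (1-t)∫ j dP + t j(x) ≤ C,
while Gibbs gives ∫ j dP ≥ C. Hence j(x) ≤ C for each t, and no derivative of the information in t
is needed. -/
theorem IsCapacityAchieving.infoDensity_mixDirac_le (h : IsCapacityAchieving A P)
    (hP : ¬ ∀ᵐ x ∂P, x = 0) {t x : ℝ} (ht : 0 < t) (ht1 : t < 1) (h0 : 0 ≤ x) (hA : x ≤ A) :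
    infoDensity (mom (mixDirac P t x)) x ≤ capacity A := by
  have hQ := isInput_mixDirac h.1 ht.le ht1.le h0 hA
  have hg := expGrowth_log_mom hQ
  have hpos : ∀ y, 0 < mom (mixDirac P t x) y := fun y => by
    rw [mom, integral_mixDirac h.1 x ht.le ht1.le (continuous_momFun y)]
    have h1 : 0 < (1 - t) * mom P y := mul_pos (by linarith) (mom_pos h.1 hP y)
    have h2 : 0 ≤ t * (x ^ y * Real.exp (-x)) := by positivity
    exact add_pos_of_pos_of_nonneg h1 h2
  have h1 := info_le_capacity hQ
  have h2 := info_le_integral h.1 hg hpos (hasSum_mom hQ)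
  rw [info, integral_mixDirac h.1 x ht.le ht1.le (continuous_infoDensity hg)] at h1
  rw [h.info_eq] at h2
  have h3 := mul_le_mul_of_nonneg_left h2 (show 0 ≤ 1 - t by linarith)
  nlinarith

/-- Dominated convergence: for t < 1/2 the moments of the mixture stay between m(y)/2 and A^y, so
their logarithms have a common bound of exponential growth. -/
theorem tendsto_infoDensity_mixDirac (h : IsInput A P) (hP : ¬ ∀ᵐ x ∂P, x = 0) {x : ℝ}
    (h0 : 0 ≤ x) (hA : x ≤ A) :
    Tendsto (fun t => infoDensity (mom (mixDirac P t x)) x) (𝓝[>] 0)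
      (𝓝 (infoDensity (mom P) x)) := by
  have hIoo : Set.Ioo (0 : ℝ) (1 / 2) ∈ 𝓝[>] (0 : ℝ) := Ioo_mem_nhdsGT (by norm_num)
  have hmom : ∀ y, ∀ t ∈ Set.Ioo (0 : ℝ) (1 / 2), mom (mixDirac P t x) y
      = (1 - t) * mom P y + t * (x ^ y * Real.exp (-x)) := fun y t ht =>
    integral_mixDirac h x ht.1.le (by linarith [ht.2]) (continuous_momFun y)
  refine tendsto_const_nhds.sub (Tendsto.const_mul _ ?_)
  have hgr : ExpGrowth fun y => |Real.log (mom P y)| + (Real.log 2 + |Real.log A| * y) :=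
    (expGrowth_log_mom h).abs.add
      ((ExpGrowth.const _).add ((ExpGrowth.const _).mul ExpGrowth.natCast))
  refine tendsto_tsum_of_dominated_convergence (hgr.summable x) (fun y => ?_) ?_
  · refine Tendsto.mul_const _ (Tendsto.log ?_ (mom_pos h hP y).ne')
    have h1 : Tendsto (fun t : ℝ => (1 - t) * mom P y + t * (x ^ y * Real.exp (-x))) (𝓝[>] 0)
        (𝓝 ((1 - 0) * mom P y + 0 * (x ^ y * Real.exp (-x)))) :=
      (Continuous.tendsto (by fun_prop) _).mono_left nhdsWithin_le_nhds
    rw [sub_zero, one_mul, zero_mul, add_zero] at h1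
    refine h1.congr' ?_
    filter_upwards [hIoo] with t ht using (hmom y t ht).symm
  · filter_upwards [hIoo] with t ht y
    have hQ := isInput_mixDirac h ht.1.le (by linarith [ht.2]) h0 hA
    have hm := mom_pos h hP y
    have h1 : mom P y / 2 ≤ mom (mixDirac P t x) y := by
      rw [hmom y t ht]
      have h2 : 0 ≤ t * (x ^ y * Real.exp (-x)) := mul_nonneg ht.1.le (by positivity)
      nlinarith [ht.2]
    have h3 := Real.log_le_log (by positivity) h1
    have h4 := Real.log_le_log (by linarith) (mom_le hQ y)
    rw [Real.log_div hm.ne' (by norm_num)] at h3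
    rw [Real.log_pow] at h4
    have h5 : y * Real.log A ≤ |Real.log A| * y := by
      rw [mul_comm]; gcongr; exact le_abs_self _
    have h6 := neg_abs_le (Real.log (mom P y))
    have h7 : 0 ≤ |Real.log A| * y := by positivity
    have h8 : 0 ≤ Real.log 2 := Real.log_nonneg (by norm_num)
    rw [norm_mul, Real.norm_eq_abs, Real.norm_of_nonneg (show 0 ≤ x ^ y / (y.factorial : ℝ) by positivity)]
    gcongr
    rw [abs_le]
    constructor <;> linarith [abs_nonneg (Real.log (mom P y))]

theorem IsCapacityAchieving.infoDensity_le (h : IsCapacityAchieving A P)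
    (hP : ¬ ∀ᵐ x ∂P, x = 0) {x : ℝ} (h0 : 0 ≤ x) (hA : x ≤ A) :
    infoDensity (mom P) x ≤ capacity A := by
  refine le_of_tendsto (tendsto_infoDensity_mixDirac h.1 hP h0 hA) ?_
  filter_upwards [Ioo_mem_nhdsGT (show (0 : ℝ) < 1 by norm_num)] with t ht
  exact h.infoDensity_mixDirac_le hP ht.1 ht.2 h0 hA

theorem IsInput.support_subset (h : IsInput A P) : P.support ⊆ Set.Icc 0 A :=
  Measure.support_subset_of_isClosed isClosed_Icc h.2

/-- The nonnegative function C - i has integral zero, so it vanishes almost surely; its zero set is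
closed and hence contains the support. -/
theorem IsCapacityAchieving.infoDensity_eq (h : IsCapacityAchieving A P)
    (hP : ¬ ∀ᵐ x ∂P, x = 0) {x : ℝ} (hx : x ∈ P.support) :
    infoDensity (mom P) x = capacity A := by
  have := h.1.1
  have hc := continuous_infoDensity (expGrowth_log_mom h.1)
  have h1 : ∫ z, (capacity A - infoDensity (mom P) z) ∂P = 0 := by
    rw [integral_sub (integrable_const _) (h.1.integrable hc)]
    have := h.info_eq
    rw [info] at this
    simp [this]
  have h2 := (integral_eq_zero_iff_of_nonneg_ae
    (h.1.2.mono fun z hz => sub_nonneg.mpr (h.infoDensity_le hP hz.1 hz.2))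
    ((integrable_const _).sub (h.1.integrable hc))).mp h1
  have h3 : P.support ⊆ {z | infoDensity (mom P) z = capacity A} :=
    Measure.support_subset_of_isClosed (isClosed_eq hc continuous_const)
      (h2.mono fun z hz => (sub_eq_zero.mp hz).symm)
  exact h3 hx

end PoissonChannel

end

noncomputable section

namespace PoissonChannel

open Topology

/-! ### Local maxima -/

theorem deriv_nonneg_of_le_left {f : ℝ → ℝ} {f' l x : ℝ} (hf : HasDerivAt f f' x) (hl : l < x)
    (h : ∀ z ∈ Set.Ioo l x, f z ≤ f x) : 0 ≤ f' := by
  have h1 := (hasDerivWithinAt_iff_tendsto_slope' (s := Set.Iio x) (by simp)).mp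
    hf.hasDerivWithinAt
  refine ge_of_tendsto h1 ?_
  filter_upwards [Ioo_mem_nhdsLT hl] with z hz
  rw [slope_def_field]
  exact div_nonneg_of_nonpos (by linarith [h z hz]) (by linarith [hz.2])

theorem deriv_nonpos_of_le_right {f : ℝ → ℝ} {f' r x : ℝ} (hf : HasDerivAt f f' x) (hr : x < r)
    (h : ∀ z ∈ Set.Ioo x r, f z ≤ f x) : f' ≤ 0 := by
  have h1 := (hasDerivWithinAt_iff_tendsto_slope' (s := Set.Ioi x) (by simp)).mp
    hf.hasDerivWithinAt
  refine le_of_tendsto h1 ?_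
  filter_upwards [Ioo_mem_nhdsGT hr] with z hz
  rw [slope_def_field]
  exact div_nonpos_of_nonpos_of_nonneg (by linarith [h z hz]) (by linarith [hz.1])

/-- If f'' were positive, f' would be positive just to the right of x, and the mean value theorem
would produce a larger value of f. -/
theorem deriv_eq_zero_and_deriv_nonpos_of_max {f f' : ℝ → ℝ} {f'' l r x : ℝ} (hx : x ∈ Set.Ioo l r)
    (hf : ∀ z ∈ Set.Ioo l r, HasDerivAt f (f' z) z) (hf' : HasDerivAt f' f'' x)
    (h : ∀ z ∈ Set.Ioo l r, f z ≤ f x) : f' x = 0 ∧ f'' ≤ 0 := by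
  have h0 : f' x = 0 := le_antisymm
    (deriv_nonpos_of_le_right (hf x hx) hx.2 fun z hz => h z ⟨hx.1.trans hz.1, hz.2⟩)
    (deriv_nonneg_of_le_left (hf x hx) hx.1 fun z hz => h z ⟨hz.1, hz.2.trans hx.2⟩)
  refine ⟨h0, ?_⟩
  by_contra! hpos
  have h1 := (hasDerivWithinAt_iff_tendsto_slope' (s := Set.Ioi x) (by simp)).mp
    hf'.hasDerivWithinAt
  have h2 := (h1.eventually (lt_mem_nhds hpos)).and (Ioo_mem_nhdsGT hx.2)
  obtain ⟨u, hu, hsub⟩ := mem_nhdsGT_iff_exists_Ioo_subset.mp h2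
  have hxu : x < u := hu
  have hb : (x + u) / 2 ∈ Set.Ioo x u := ⟨by linarith, by linarith⟩
  set b := (x + u) / 2
  have hin : ∀ z ∈ Set.Ioc x b, z ∈ Set.Ioo l r := fun z hz =>
    ⟨hx.1.trans hz.1, (hsub ⟨hz.1, hz.2.trans_lt hb.2⟩).2.2⟩
  obtain ⟨c, hc, hc'⟩ := exists_hasDerivAt_eq_slope f f' hb.1
    (fun z hz => by
      rcases hz.1.eq_or_lt with rfl | hz1
      · exact (hf _ hx).continuousAt.continuousWithinAt
      · exact (hf z (hin z ⟨hz1, hz.2⟩)).continuousAt.continuousWithinAt)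
    (fun z hz => hf z (hin z ⟨hz.1, hz.2.le⟩))
  have h3 := (hsub ⟨hc.1, hc.2.trans hb.2⟩).1
  rw [slope_def_field, h0, sub_zero] at h3
  have h4 : 0 < f' c := by
    have := (div_pos_iff_of_pos_right (show 0 < c - x by linarith [hc.1])).mp h3
    exact this
  have h5 : (f b - f x) / (b - x) ≤ 0 :=
    div_nonpos_of_nonpos_of_nonneg (by linarith [h b (hin b ⟨hb.1, le_rfl⟩)]) (by linarith [hb.1])
  linarith

/-! ### Derivatives of the information density -/

variable {A : ℝ} {P : Measure ℝ}

/-- The derivative of the information density. -/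
def infoDeriv (P : Measure ℝ) (x : ℝ) : ℝ :=
  Real.log x - poissonExp (fun y => Real.log (condMean P y)) x

theorem hasDerivAt_infoDensity (h : IsInput A P) (hP : ¬ ∀ᵐ x ∂P, x = 0) {x : ℝ} (hx : 0 < x) :
    HasDerivAt (infoDensity (mom P)) (infoDeriv P x) x := by
  have h1 := ((Real.hasDerivAt_mul_log hx.ne').sub (hasDerivAt_id x)).sub
    (poissonExp_hasDerivAt (expGrowth_log_mom h) x)
  convert! h1 using 1
  simp only [infoDeriv, log_condMean_eq h hP]
  ring

theorem hasDerivAt_infoDeriv (h : IsInput A P) (hP : ¬ ∀ᵐ x ∂P, x = 0) {x : ℝ} (hx : 0 < x) :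
    HasDerivAt (infoDeriv P) (x⁻¹ - poissonExp (fun y => Real.log (condMean P (y + 1))
      - Real.log (condMean P y)) x) x :=
  (Real.hasDerivAt_log hx.ne').sub (poissonExp_hasDerivAt (expGrowth_log_condMean h hP) x)

/-! ### Positivity of the capacity -/

theorem capacity_pos (hA : 0 < A) : 0 < capacity A := by
  have hQ := isInput_mixDirac (isInput_dirac le_rfl hA.le) (t := 1 / 2) (by norm_num) (by norm_num)
    hA.le le_rfl
  set Q := mixDirac (Measure.dirac 0) (1 / 2) A with hQdef
  have := hQ.1
  have := isProbabilityMeasure_outputLaw hQ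
  refine lt_of_lt_of_le ?_ (info_le_capacity hQ)
  refine lt_of_le_of_ne (info_nonneg hQ) fun h0 => ?_
  have h1 : mutualInfo Q = 0 := by rw [mutualInfo_eq_ofReal hQ, ← h0, ENNReal.ofReal_zero]
  rw [mutualInfo, InformationTheory.klDiv_eq_zero_iff] at h1
  -- Zero information would make the fair law on {0, A} independent of its output. On this rectangle
  -- that reads e^(-A) = (1 + e^(-A))/2.
  have h2 := congrArg (fun μ => μ ({A} ×ˢ {0})) h1
  simp only [Measure.compProd_apply_prod (measurableSet_singleton A) (measurableSet_singleton 0),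
    Measure.prod_prod, Measure.restrict_singleton, lintegral_smul_measure, lintegral_dirac,
    smul_eq_mul] at h2
  have hQA : Q {A} ≠ 0 := by
    rw [hQdef, mixDirac]
    simp
  have h3 := (ENNReal.mul_right_inj hQA (measure_ne_top _ _)).mp h2
  rw [channel_singleton hA.le, outputLaw_singleton hQ, mom, integral_mixDirac
    (isInput_dirac le_rfl hA.le) A (by norm_num) (by norm_num) (continuous_momFun 0),
    ENNReal.ofReal_eq_ofReal_iff (by positivity) (by simp; positivity)] at h3
  simp at h3
  have : Real.exp (-A) < 1 := Real.exp_lt_one_iff.mpr (by linarith)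
  linarith

theorem infoDensity_eq_zero_of_ae_eq (h : IsInput A P) {c : ℝ} (hc : ∀ᵐ x ∂P, x = c) :
    infoDensity (mom P) c = 0 := by
  have := h.1
  have hm : ∀ y, mom P y = c ^ y * Real.exp (-c) := fun y => by
    rw [mom, integral_congr_ae (g := fun _ => c ^ y * Real.exp (-c))]
    · simp
    · filter_upwards [hc] with x hx
      rw [hx]
  obtain ⟨z, hz, rfl⟩ := (h.2.and hc).exists
  rcases hz.1.eq_or_lt with rfl | h0
  · simp [infoDensity, poissonExp_zero, hm]
  · have e : (fun y => Real.log (mom P y)) = fun y : ℕ => Real.log z * y - z := by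
      ext y
      rw [hm, Real.log_mul (by positivity) (by positivity), Real.log_pow, Real.log_exp]
      ring
    rw [infoDensity, e, poissonExp_sub ((ExpGrowth.const _).mul ExpGrowth.natCast)
      (ExpGrowth.const _), poissonExp_const_mul, poissonExp_natCast, poissonExp_const]
    ring

theorem info_eq_zero_of_ae_eq (h : IsInput A P) {c : ℝ} (hc : ∀ᵐ x ∂P, x = c) : info P = 0 := by
  rw [info, integral_congr_ae (g := fun _ => 0)]
  · simp
  · filter_upwards [hc] with x hx
    rw [hx, infoDensity_eq_zero_of_ae_eq h hc]

theorem IsCapacityAchieving.not_ae_eq (h : IsCapacityAchieving A P) (hA : 0 < A) (c : ℝ) :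
    ¬ ∀ᵐ x ∂P, x = c := by
  intro hc
  have h1 := info_eq_zero_of_ae_eq h.1 hc
  rw [h.info_eq] at h1
  exact (capacity_pos hA).ne' h1

/-! ### The endpoints belong to the support -/

theorem IsInput.exists_isLeast_support (h : IsInput A P) : ∃ x, IsLeast P.support x := by
  have := h.1
  exact (isCompact_Icc.of_isClosed_subset Measure.isClosed_support h.support_subset).exists_isLeast
    (Measure.nonempty_support (IsProbabilityMeasure.ne_zero P))

theorem IsInput.exists_isGreatest_support (h : IsInput A P) : ∃ x, IsGreatest P.support x := by
  have := h.1
  exact (isCompact_Icc.of_isClosed_subset Measure.isClosed_support h.support_subset).exists_isGreatest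
    (Measure.nonempty_support (IsProbabilityMeasure.ne_zero P))

namespace IsCapacityAchieving

/-- If the least support point x were positive, all conditional means would be at least x, strictly
so at output 0. Then i'(x) < 0 and i would exceed C to the left of x. The argument at A is the
mirror image. -/
theorem zero_mem_support (h : IsCapacityAchieving A P) (hA : 0 < A) : 0 ∈ P.support := by
  have hP := h.not_ae_eq hA 0
  obtain ⟨x, hx⟩ := h.1.exists_isLeast_support
  have hx0 := h.1.support_subset hx.1
  rcases hx0.1.eq_or_lt with rfl | hpos
  · exact hx.1
  exfalso
  have hae : ∀ᵐ z ∂P, x ≤ z := by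
    filter_upwards [Measure.support_mem_ae (μ := P)] with z hz using hx.2 hz
  have h1 : infoDeriv P x < 0 := by
    rw [infoDeriv, sub_neg]
    have := poissonExp_lt (ExpGrowth.const (Real.log x)) (expGrowth_log_condMean h.1 hP) hpos.le
      (fun y => Real.log_le_log hpos (le_condMean_of_ae h.1 hP hae y))
      (Real.log_lt_log hpos (lt_condMean_zero h.1 hP hae (h.not_ae_eq hA x)))
    rwa [poissonExp_const] at this
  refine h1.not_ge (deriv_nonneg_of_le_left (hasDerivAt_infoDensity h.1 hP hpos) hpos fun z hz => ?_)
  rw [h.infoDensity_eq hP hx.1]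
  exact h.infoDensity_le hP hz.1.le (hz.2.le.trans hx0.2)

theorem right_mem_support (h : IsCapacityAchieving A P) (hA : 0 < A) : A ∈ P.support := by
  have hP := h.not_ae_eq hA 0
  obtain ⟨x, hx⟩ := h.1.exists_isGreatest_support
  have hx0 := h.1.support_subset hx.1
  rcases hx0.2.eq_or_lt with rfl | hlt
  · exact hx.1
  exfalso
  have hae : ∀ᵐ z ∂P, z ≤ x := by
    filter_upwards [Measure.support_mem_ae (μ := P)] with z hz using hx.2 hz
  have hpos : 0 < x := (condMean_pos h.1 hP 0).trans (condMean_zero_lt h.1 hP hae (h.not_ae_eq hA x))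
  have h1 : 0 < infoDeriv P x := by
    rw [infoDeriv, sub_pos]
    have := poissonExp_lt (expGrowth_log_condMean h.1 hP) (ExpGrowth.const (Real.log x)) hpos.le
      (fun y => Real.log_le_log (condMean_pos h.1 hP y) (condMean_le_of_ae h.1 hP hae y))
      (Real.log_lt_log (condMean_pos h.1 hP 0) (condMean_zero_lt h.1 hP hae (h.not_ae_eq hA x)))
    rwa [poissonExp_const] at this
  refine h1.not_ge (deriv_nonpos_of_le_right (hasDerivAt_infoDensity h.1 hP hpos) hlt fun z hz => ?_)
  rw [h.infoDensity_eq hP hx.1]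
  exact h.infoDensity_le hP (hpos.le.trans hz.1.le) hz.2.le

theorem capacity_eq (h : IsCapacityAchieving A P) (hA : 0 < A) :
    capacity A = -Real.log (mom P 0) := by
  rw [← h.infoDensity_eq (h.not_ae_eq hA 0) (h.zero_mem_support hA), infoDensity, poissonExp_zero]
  simp

theorem mom_zero_eq (h : IsCapacityAchieving A P) (hA : 0 < A) :
    mom P 0 = Real.exp (-capacity A) := by
  rw [h.capacity_eq hA, neg_neg, Real.exp_log (mom_zero_pos h.1)]

theorem capacity_le (h : IsCapacityAchieving A P) (hA : 0 < A) : capacity A ≤ A := by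
  have := h.1.1
  have h1 := h.1.integral_mono (continuous_const (y := Real.exp (-A))) (continuous_momFun 0)
    fun x _ hx => by simpa using hx
  have h2 : Real.exp (-A) ≤ mom P 0 := by simpa [mom] using h1
  rw [h.mom_zero_eq hA, Real.exp_le_exp] at h2
  linarith

/-! ### Interior support points -/

theorem infoDeriv_eq_zero_and_le (h : IsCapacityAchieving A P) {x : ℝ} (hx : x ∈ P.support)
    (h0 : 0 < x) (hxA : x < A) : infoDeriv P x = 0 ∧ x⁻¹ + Real.log x ≤
      poissonExp (fun y => Real.log (condMean P (y + 1))) x := by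
  have hP := h.not_ae_eq (h0.trans hxA) 0
  have hg := expGrowth_log_condMean h.1 hP
  obtain ⟨h1, h2⟩ := deriv_eq_zero_and_deriv_nonpos_of_max (l := 0) (r := A) ⟨h0, hxA⟩
    (fun z hz => hasDerivAt_infoDensity h.1 hP hz.1) (hasDerivAt_infoDeriv h.1 hP h0)
    fun z hz => by
      rw [h.infoDensity_eq hP hx]
      exact h.infoDensity_le hP hz.1.le hz.2.le
  refine ⟨h1, ?_⟩
  rw [poissonExp_sub hg.shift hg] at h2
  rw [infoDeriv] at h1
  linarith

/-- The second-order condition with every conditional mean bounded by A. This inequality alone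
yields the location of interior points and the gap below A. -/
theorem one_le_mul_log (h : IsCapacityAchieving A P) {x : ℝ} (hx : x ∈ P.support)
    (h0 : 0 < x) (hxA : x < A) : 1 ≤ x * Real.log (A / x) := by
  have hP := h.not_ae_eq (h0.trans hxA) 0
  have h1 := (h.infoDeriv_eq_zero_and_le hx h0 hxA).2
  have h2 := poissonExp_mono (expGrowth_log_condMean h.1 hP).shift (ExpGrowth.const (Real.log A))
    h0.le fun y => Real.log_le_log (condMean_pos h.1 hP _) (condMean_le h.1 hP _)
  rw [poissonExp_const] at h2
  rw [Real.log_div (h0.trans hxA).ne' h0.ne']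
  have h3 : x * x⁻¹ = 1 := mul_inv_cancel₀ h0.ne'
  nlinarith

theorem mem_Ioo_of_mem_support (h : IsCapacityAchieving A P) {x : ℝ} (hx : x ∈ P.support \ {0, A}) :
    0 < x ∧ x < A := by
  have h1 := h.1.support_subset hx.1
  have h2 := hx.2
  simp only [Set.mem_insert_iff, Set.mem_singleton_iff, not_or] at h2
  exact ⟨lt_of_le_of_ne h1.1 (Ne.symm h2.1), lt_of_le_of_ne h1.2 h2.2⟩

end IsCapacityAchieving

theorem le_sub_one_of_one_le_mul_log {x : ℝ} (h0 : 0 < x) (hA : 0 < A)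
    (h : 1 ≤ x * Real.log (A / x)) : x ≤ A - 1 := by
  have h1 := Real.log_le_sub_one_of_pos (div_pos hA h0)
  have h2 := mul_le_mul_of_nonneg_left h1 h0.le
  have h3 : x * (A / x - 1) = A - x := by field_simp
  linarith

namespace IsCapacityAchieving

/-- Interior support points are at most A - 1, so A is isolated in the support and must be an atom.
-/
theorem measure_right_pos (h : IsCapacityAchieving A P) (hA : 0 < A) : 0 < P {A} := by
  have h1 := (Measure.mem_support_iff_forall A).mp (h.right_mem_support hA)
    (Set.Ioi (max 0 (A - 1))) (Ioi_mem_nhds (by simp [hA]))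
  refine h1.trans_le ?_
  refine measure_mono_ae ?_
  filter_upwards [Measure.support_mem_ae (μ := P)] with x hx hx1
  have hx1' : max 0 (A - 1) < x := hx1
  rw [max_lt_iff] at hx1'
  by_contra hne
  have hlt : x < A := lt_of_le_of_ne (h.1.support_subset hx).2 hne
  have := le_sub_one_of_one_le_mul_log hx1'.1 hA (h.one_le_mul_log hx hx1'.1 hlt)
  linarith [hx1'.2]

end IsCapacityAchieving

end PoissonChannel

end

noncomputable section

namespace PoissonChannel

open Topology

variable {A : ℝ} {P : Measure ℝ}

/-! ### The number of support points -/

theorem measureReal_mul_le_mom (h : IsInput A P) {s : Set ℝ} (hs : NullMeasurableSet s P) {y : ℕ}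
    {c : ℝ} (hc : ∀ᵐ x ∂P, x ∈ s → c ≤ x ^ y * Real.exp (-x)) : P.real s * c ≤ mom P y := by
  have := h.1
  have e : P.real s * c = ∫ x, s.indicator (fun _ => c) x ∂P := by
    rw [integral_indicator₀ hs, setIntegral_const, smul_eq_mul]
  rw [e, mom]
  refine integral_mono_ae ((integrable_const c).indicator₀ hs) (h.integrable (continuous_momFun y)) ?_
  filter_upwards [h.2, hc] with x hx hxc
  by_cases hxs : x ∈ s
  · rw [Set.indicator_of_mem hxs]; exact hxc hxs
  · rw [Set.indicator_of_notMem hxs]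
    exact mul_nonneg (pow_nonneg hx.1 _) (Real.exp_pos _).le

theorem measureReal_singleton_mul_le_mom (h : IsInput A P) (x : ℝ) (y : ℕ) :
    P.real {x} * (x ^ y * Real.exp (-x)) ≤ mom P y :=
  measureReal_mul_le_mom h (measurableSet_singleton x).nullMeasurableSet
    (ae_of_all _ fun z hz => by rw [Set.mem_singleton_iff.mp hz])

/-- The increments of the logarithm of the conditional mean. -/
def logIncr (P : Measure ℝ) (y : ℕ) : ℝ :=
  Real.log (condMean P y) - Real.log (condMean P (y - 1))

theorem logIncr_nonneg (h : IsInput A P) (hP : ¬ ∀ᵐ x ∂P, x = 0) (y : ℕ) : 0 ≤ logIncr P y :=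
  sub_nonneg.mpr (Real.log_le_log (condMean_pos h hP _) (condMean_mono h hP (Nat.sub_le y 1)))

/-- Abel summation, since the log conditional means telescope to log m. The truncated subtraction in
`logIncr` makes the term at 0 vanish. -/
theorem sum_mul_logIncr_le (h : IsInput A P) (hP : ¬ ∀ᵐ x ∂P, x = 0) (n : ℕ) :
    ∑ y ∈ Finset.range (n + 1), y * logIncr P y
      ≤ (n : ℝ) * Real.log A - (Real.log (mom P n) - Real.log (mom P 0)) := by
  have key : ∑ y ∈ Finset.range (n + 1), y * logIncr P y
      = n * Real.log (condMean P n) - (Real.log (mom P n) - Real.log (mom P 0))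
        - (Real.log (condMean P n) - (Real.log (mom P (n + 1)) - Real.log (mom P n))) := by
    induction n with
    | zero => simp [log_condMean_eq h hP]
    | succ n ih =>
      rw [Finset.sum_range_succ, ih]
      simp only [logIncr, Nat.add_sub_cancel, log_condMean_eq h hP]
      push_cast
      ring
  rw [key, ← log_condMean_eq h hP, sub_self, sub_zero]
  gcongr
  · exact condMean_pos h hP n
  · exact condMean_le h hP n

theorem IsCapacityAchieving.card_le_of_one_le_mul_logIncr (h : IsCapacityAchieving A P) (hA : 0 < A)
    (S : Finset ℕ) (hS : ∀ y ∈ S, 1 ≤ y * logIncr P y) :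
    (S.card : ℝ) ≤ A - Real.log (P.real {A}) - capacity A := by
  have := h.1.1
  have hP := h.not_ae_eq hA 0
  have hp : 0 < P.real {A} := ENNReal.toReal_pos (h.measure_right_pos hA).ne' (measure_ne_top _ _)
  set n := S.sup id
  have hsub : S ⊆ Finset.range (n + 1) := fun y hy =>
    Finset.mem_range_succ_iff.mpr (Finset.le_sup (f := id) hy)
  have h1 : (S.card : ℝ) ≤ ∑ y ∈ S, y * logIncr P y := by
    rw [← nsmul_one, ← Finset.sum_const]
    exact Finset.sum_le_sum hS
  have h2 : ∑ y ∈ S, y * logIncr P y ≤ ∑ y ∈ Finset.range (n + 1), y * logIncr P y :=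
    Finset.sum_le_sum_of_subset_of_nonneg hsub fun y _ _ =>
      mul_nonneg (Nat.cast_nonneg _) (logIncr_nonneg h.1 hP y)
  have h3 := sum_mul_logIncr_le h.1 hP n
  have h4 := Real.log_le_log (by positivity) (measureReal_singleton_mul_le_mom h.1 A n)
  rw [Real.log_mul hp.ne' (by positivity), Real.log_mul (by positivity) (by positivity),
    Real.log_pow, Real.log_exp] at h4
  have h5 := h.capacity_eq hA
  linarith

theorem IsCapacityAchieving.card_interior_le (h : IsCapacityAchieving A P) (hA : 0 < A)
    (X : Finset ℝ) (hX : ∀ x ∈ X, x ∈ P.support \ {0, A}) :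
    (X.card : ℝ) ≤ A - Real.log (P.real {A}) - capacity A := by
  have hP := h.not_ae_eq hA 0
  have hg := expGrowth_log_condMean h.1 hP
  have hXI : ∀ x ∈ X, 0 < x ∧ x < A := fun x hx => h.mem_Ioo_of_mem_support (hX x hx)
  -- With N points in X, i equals C at N + 2 points, so Rolle gives N + 1 zeros of i'. Being
  -- strictly between neighbours in Z, they are distinct from the N points of X, which are zeros of
  -- i' too.
  set Z := insert 0 (insert A X) with hZdef
  have hZ : Z.card = X.card + 1 + 1 := by
    rw [hZdef, Finset.card_insert_of_notMem, Finset.card_insert_of_notMem]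
    · exact fun hm => (hXI A hm).2.false
    · rw [Finset.mem_insert, not_or]
      exact ⟨hA.ne, fun hm => (hXI 0 hm).1.false⟩
  have hZmem : ∀ z ∈ Z, 0 ≤ z ∧ z ≤ A ∧ infoDensity (mom P) z = capacity A := by
    intro z hz
    rw [hZdef, Finset.mem_insert, Finset.mem_insert] at hz
    rcases hz with rfl | rfl | hz
    · exact ⟨le_rfl, hA.le, h.infoDensity_eq hP (h.zero_mem_support hA)⟩
    · exact ⟨hA.le, le_rfl, h.infoDensity_eq hP (h.right_mem_support hA)⟩
    · exact ⟨(hXI z hz).1.le, (hXI z hz).2.le, h.infoDensity_eq hP (hX z hz).1⟩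
  set z := Z.orderEmbOfFin hZ with hzdef
  have hzm : ∀ j, z j ∈ Z := fun j => Z.orderEmbOfFin_mem hZ j
  obtain ⟨w, hw, hw0⟩ := exists_zeros_deriv (f := infoDensity (mom P)) (f' := infoDeriv P)
    (fun j => z j) z.strictMono
    (fun x hx => hasDerivAt_infoDensity h.1 hP ((hZmem _ (hzm 0)).1.trans_lt hx.1))
    (continuous_infoDensity (expGrowth_log_mom h.1)).continuousOn
    (c := capacity A) fun j => (hZmem _ (hzm j)).2.2
  have hwZ : ∀ j, w j ∉ Z := by
    intro j hj
    have : w j ∈ Set.range z := by rw [hzdef, Finset.range_orderEmbOfFin]; exact hj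
    obtain ⟨i, hi⟩ := this
    have h1 := (hw0 j).1
    rw [← hi] at h1
    have h2 : j.castSucc < i := z.lt_iff_lt.mp h1.1
    have h3 : i < j.succ := z.lt_iff_lt.mp h1.2
    rw [Fin.lt_def] at h2 h3
    simp at h2 h3
    omega
  set W := Finset.univ.map ⟨w, hw.injective⟩ with hWdef
  have hdisj : Disjoint W X := by
    rw [Finset.disjoint_left]
    intro x hx hxX
    obtain ⟨j, -, rfl⟩ := Finset.mem_map.mp hx
    exact hwZ j (by simp only [hZdef, Finset.mem_insert]; exact Or.inr (Or.inr hxX))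
  obtain ⟨V, hV, hV0⟩ := exists_finset_zeros_deriv (l := 0)
    (fun x hx => hasDerivAt_infoDeriv h.1 hP hx) (W ∪ X) (fun x hx => by
      rcases Finset.mem_union.mp hx with hx | hx
      · obtain ⟨j, -, rfl⟩ := Finset.mem_map.mp hx
        exact ⟨(hZmem _ (hzm _)).1.trans_lt (hw0 j).1.1, (hw0 j).2⟩
      · exact ⟨(hXI x hx).1, (h.infoDeriv_eq_zero_and_le (hX x hx).1 (hXI x hx).1 (hXI x hx).2).1⟩)
  rw [Finset.card_union_of_disjoint hdisj, hWdef, Finset.card_map, Finset.card_univ,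
    Fintype.card_fin] at hV
  -- The indices where the coefficient 1 - y·Δ log g(y) fails to be positive. Any finite subset has
  -- size at most A - log P(A) - C, so this set is finite.
  set bad : Set ℕ := {y | 1 ≤ y * logIncr P y} with hbad
  have hfin : bad.Finite := by
    by_contra hinf
    obtain ⟨S, hS, hcard⟩ := Set.Infinite.exists_subset_card_eq hinf
      (⌈A - Real.log (P.real {A}) - capacity A⌉₊ + 1)
    have h1 := h.card_le_of_one_le_mul_logIncr hA S fun y hy => hS hy
    rw [hcard] at h1
    have h2 := Nat.le_ceil (A - Real.log (P.real {A}) - capacity A)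
    push_cast at h1
    linarith
  have hS := h.card_le_of_one_le_mul_logIncr hA hfin.toFinset fun y hy => by simpa [hbad] using hy
  have hgd : ExpGrowth (logIncr P) := by
    refine ExpGrowth.unshift ?_
    simpa [logIncr] using hg.diff
  have hga : ExpGrowth fun y : ℕ => 1 - y * logIncr P y :=
    (ExpGrowth.const 1).sub (ExpGrowth.natCast.mul hgd)
  have hVcard : V.card ≤ 2 * hfin.toFinset.card := by
    refine card_zeros_egf_le hfin.toFinset hga (fun n hn => ?_) ?_ V fun v hv => ⟨(hV0 v hv).1, ?_⟩
    · have : ¬ (1 ≤ n * logIncr P n) := by simpa [hbad] using hn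
      linarith
    · refine hfin.infinite_compl.mono fun n hn => ?_
      have : ¬ (1 ≤ n * logIncr P n) := by simpa [hbad] using hn
      simp only [Set.mem_ofPred_eq]
      linarith
    · obtain ⟨hv0, hv1⟩ := hV0 v hv
      -- The generating function at v equals v e^v times the second derivative of the information
      -- density.
      rw [egf_sub (ExpGrowth.const 1) (ExpGrowth.natCast.mul hgd), egf_natCast_mul hgd]
      have e1 : egf (fun _ => (1 : ℝ)) v = Real.exp v := by
        simpa using egf_pow 1 v
      simp only [poissonExp] at hv1
      simp only [logIncr, Nat.add_sub_cancel, e1]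
      set G := egf (fun y => Real.log (condMean P (y + 1)) - Real.log (condMean P y)) v
      have e2 : Real.exp v * Real.exp (-v) = 1 := by rw [← Real.exp_add]; simp
      have e3 : v * v⁻¹ = 1 := mul_inv_cancel₀ hv0.ne'
      linear_combination v * Real.exp v * hv1 + v * G * e2 - Real.exp v * e3
  refine le_trans ?_ hS
  exact_mod_cast (by omega : X.card ≤ hfin.toFinset.card)

namespace IsCapacityAchieving

theorem finite_interior (h : IsCapacityAchieving A P) (hA : 0 < A) : (P.support \ {0, A}).Finite := by
  by_contra hinf
  obtain ⟨S, hS, hcard⟩ := Set.Infinite.exists_subset_card_eq hinf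
    (⌈A - Real.log (P.real {A}) - capacity A⌉₊ + 1)
  have h1 := h.card_interior_le hA S fun y hy => hS hy
  rw [hcard] at h1
  have h2 := Nat.le_ceil (A - Real.log (P.real {A}) - capacity A)
  push_cast at h1
  linarith

theorem finite_support (h : IsCapacityAchieving A P) (hA : 0 < A) : P.support.Finite :=
  ((h.finite_interior hA).union (Set.toFinite {0, A})).subset (by
    rw [Set.sdiff_union_self]
    exact Set.subset_union_left)

theorem ncard_support_le (h : IsCapacityAchieving A P) (hA : 0 < A) :
    (P.support.ncard : ℤ) ≤ ⌈A - Real.log (P.real {A}) - capacity A⌉ + 2 := by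
  have h1 : P.support.ncard ≤ (P.support \ {0, A}).ncard + 2 := by
    refine (Set.ncard_le_ncard_sdiff_add_ncard P.support {0, A}).trans ?_
    gcongr
    exact (Set.ncard_insert_le _ _).trans (by simp)
  have h2 := h.card_interior_le hA (h.finite_interior hA).toFinset (by simp)
  rw [← Set.ncard_eq_toFinset_card _ (h.finite_interior hA)] at h2
  have h3 : ((P.support \ {0, A}).ncard : ℤ) ≤ ⌈A - Real.log (P.real {A}) - capacity A⌉ := by
    have := h2.trans (Int.le_ceil _)
    exact_mod_cast this
  omega

/-! ### Upper bounds on the probabilities -/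

/-- In i(x) = C, bound m(y) below by p x^y e^(-x) for y ≥ 1 but keep the exact value log m(0) = -C.
The indicator of output 0 contributes e^(-x), which is the source of the denominator 1 - e^(-x). -/
theorem measureReal_le_of_ne_zero (h : IsCapacityAchieving A P) (hA : 0 < A) {x : ℝ}
    (hx : x ∈ P.support \ {0}) : P.real {x} ≤ Real.exp (-capacity A
      - x * (Real.exp (-x) / (1 - Real.exp (-x)))) := by
  have := h.1.1
  have hP := h.not_ae_eq hA 0
  have hx0 : 0 < x := lt_of_le_of_ne (h.1.support_subset hx.1).1 (Ne.symm hx.2)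
  rcases (measureReal_nonneg (μ := P) (s := {x})).eq_or_lt with hp | hp
  · rw [← hp]; positivity
  have h1 := h.infoDensity_eq hP hx.1
  rw [infoDensity] at h1
  set p := P.real {x}
  have g1 : ExpGrowth fun y : ℕ => Real.log x * y + (Real.log p - x) :=
    ((ExpGrowth.const _).mul ExpGrowth.natCast).add (ExpGrowth.const _)
  have g2 := ExpGrowth.ite_zero (-capacity A - Real.log p + x)
  have h2 := poissonExp_mono (g1.add g2) (expGrowth_log_mom h.1) hx0.le fun y => by
    rcases Nat.eq_zero_or_pos y with rfl | hy
    · simp [h.capacity_eq hA]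
    · have := Real.log_le_log (by positivity) (measureReal_singleton_mul_le_mom h.1 x y)
      rw [Real.log_mul hp.ne' (by positivity), Real.log_mul (by positivity) (by positivity),
        Real.log_pow, Real.log_exp] at this
      simp only [hy.ne', if_false]
      linarith
  rw [poissonExp_add g1 g2, poissonExp_add ((ExpGrowth.const _).mul ExpGrowth.natCast)
    (ExpGrowth.const _), poissonExp_const_mul, poissonExp_natCast, poissonExp_const,
    poissonExp_ite_zero] at h2
  have h3 : Real.exp (-x) < 1 := Real.exp_lt_one_iff.mpr (by linarith)
  rw [← Real.log_le_iff_le_exp hp, le_sub_iff_add_le, ← mul_div_assoc, ← le_sub_iff_add_le',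
    div_le_iff₀ (by linarith)]
  nlinarith

theorem mom_succ_of_support_subset (h : IsCapacityAchieving A P) (hs : P.support ⊆ {0, A}) (y : ℕ) :
    mom P (y + 1) = P.real {A} * (A ^ (y + 1) * Real.exp (-A)) := by
  have := h.1.1
  have e : P.real {A} * (A ^ (y + 1) * Real.exp (-A))
      = ∫ x, ({A} : Set ℝ).indicator (fun _ => A ^ (y + 1) * Real.exp (-A)) x ∂P := by
    rw [integral_indicator (measurableSet_singleton A), setIntegral_const, smul_eq_mul]
  rw [e, mom]
  refine integral_congr_ae ?_
  filter_upwards [Measure.support_mem_ae (μ := P)] with x hx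
  by_cases hxA : x = A
  · simp [hxA]
  · have : x = 0 := (hs hx).resolve_right hxA
    rw [Set.indicator_of_notMem (by simpa using hxA)]
    simp [this]

/-- When the support is {0, A}, the lower bound p A^y e^(-A) for m(y) is an equality at every y ≥ 1.
-/
theorem measureReal_eq_of_encard_eq_two (h : IsCapacityAchieving A P) (hA : 0 < A)
    (h2 : P.support.encard = 2) {x : ℝ} (hx : x ∈ P.support \ {0}) :
    P.real {x} = Real.exp (-capacity A - x * (Real.exp (-x) / (1 - Real.exp (-x)))) := by
  have := h.1.1
  have hP := h.not_ae_eq hA 0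
  have hs : ({0, A} : Set ℝ) = P.support := by
    refine Set.Finite.eq_of_subset_of_encard_le (Set.toFinite _) ?_ ?_
    · rintro z (rfl | rfl)
      · exact h.zero_mem_support hA
      · exact h.right_mem_support hA
    · rw [h2, Set.encard_pair hA.ne]
  obtain rfl : x = A := by
    have := hx.1
    rw [← hs] at this
    exact this.resolve_left hx.2
  have hp : 0 < P.real {x} := ENNReal.toReal_pos (h.measure_right_pos hA).ne' (measure_ne_top _ _)
  have h1 := h.infoDensity_eq hP hx.1
  rw [infoDensity] at h1
  set p := P.real {x} with hpdef
  have g1 : ExpGrowth fun y : ℕ => Real.log x * y + (Real.log p - x) :=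
    ((ExpGrowth.const _).mul ExpGrowth.natCast).add (ExpGrowth.const _)
  have g2 := ExpGrowth.ite_zero (-capacity x - Real.log p + x)
  have e : (fun y => Real.log (mom P y)) = fun y : ℕ => (Real.log x * y + (Real.log p - x)) +
      (if y = 0 then -capacity x - Real.log p + x else 0) := by
    ext y
    rcases y with _ | y
    · simp [h.capacity_eq hA]
    · rw [h.mom_succ_of_support_subset hs.symm.subset y, ← hpdef, Real.log_mul hp.ne' (by positivity),
        Real.log_mul (by positivity) (by positivity), Real.log_pow, Real.log_exp]
      simp
      ring
  rw [e, poissonExp_add g1 g2, poissonExp_add ((ExpGrowth.const _).mul ExpGrowth.natCast)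
    (ExpGrowth.const _), poissonExp_const_mul, poissonExp_natCast, poissonExp_const,
    poissonExp_ite_zero] at h1
  have h3 : Real.exp (-x) < 1 := Real.exp_lt_one_iff.mpr (by linarith)
  have h4 : 1 - Real.exp (-x) ≠ 0 := by linarith
  rw [← Real.exp_log hp]
  congr 1
  field_simp
  linarith

theorem measureReal_le (h : IsCapacityAchieving A P) (hA : 0 < A) {x : ℝ} (hx : x ∈ P.support) :
    P.real {x} ≤ Real.exp (-(capacity A / (1 - Real.exp (-A)))) := by
  have := h.1.1
  have hq : Real.exp (-A) < 1 := Real.exp_lt_one_iff.mpr (by linarith)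
  have hq0 := Real.exp_pos (-A)
  by_cases hx0 : x = 0
  · subst hx0
    set p := P.real {(0 : ℝ)}
    have h1 : p + (1 - p) * Real.exp (-A) ≤ Real.exp (-capacity A) := by
      rw [← h.mom_zero_eq hA]
      have e : p + (1 - p) * Real.exp (-A) = ∫ x, (({(0 : ℝ)} : Set ℝ).indicator
          (fun _ => 1 - Real.exp (-A)) x + Real.exp (-A)) ∂P := by
        rw [integral_add ((integrable_const _).indicator (measurableSet_singleton _))
          (integrable_const _), integral_indicator (measurableSet_singleton _), setIntegral_const]
        simp [p]
        ring
      rw [e, mom]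
      refine integral_mono_ae (((integrable_const _).indicator (measurableSet_singleton _)).add
          (integrable_const _)) (h.1.integrable (continuous_momFun 0)) ?_
      filter_upwards [h.1.2] with z hz
      by_cases hz0 : z = 0
      · simp [hz0]
      · rw [Set.indicator_of_notMem (by simpa using hz0)]
        simpa using hz.2
    -- The previous bound gives p ≤ (e^(-C) - e^(-A))/(1 - e^(-A)); Bernoulli's inequality with
    -- exponent 1/(1 - e^(-A)) ≥ 1 finishes.
    have h2 := one_add_mul_self_le_rpow_one_add (s := Real.exp (-capacity A) - 1)
      (by linarith [Real.exp_pos (-capacity A)]) (p := 1 / (1 - Real.exp (-A)))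
      (by rw [le_div_iff₀ (by linarith)]; linarith)
    rw [add_sub_cancel, ← Real.exp_mul] at h2
    refine le_trans ?_ (h2.trans_eq (by ring_nf))
    have h3 : 1 - Real.exp (-A) ≠ 0 := by linarith
    have h4 : 1 + 1 / (1 - Real.exp (-A)) * (Real.exp (-capacity A) - 1)
        = (Real.exp (-capacity A) - Real.exp (-A)) / (1 - Real.exp (-A)) := by
      field_simp
      ring
    rw [h4, le_div_iff₀ (by linarith)]
    linarith
  · refine (h.measureReal_le_of_ne_zero hA ⟨hx, hx0⟩).trans (Real.exp_le_exp.mpr ?_)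
    have hxI := h.1.support_subset hx
    have hpos : 0 < x := lt_of_le_of_ne hxI.1 (Ne.symm hx0)
    have hqx : Real.exp (-x) < 1 := Real.exp_lt_one_iff.mpr (by linarith)
    -- Convexity of exp makes x/(e^x - 1) decreasing, so the correction term is smallest at x = A;
    -- then C ≤ A is used.
    have h1 : A * (Real.exp x - 1) ≤ x * (Real.exp A - 1) := by
      have := convexOn_exp.2 (Set.mem_univ 0) (Set.mem_univ A)
        (show 0 ≤ 1 - x / A by rw [sub_nonneg, div_le_one hA]; exact hxI.2)
        (show 0 ≤ x / A by positivity) (by ring)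
      simp only [smul_eq_mul, mul_zero, zero_add, Real.exp_zero, mul_one] at this
      rw [div_mul_cancel₀ _ hA.ne'] at this
      have h2 := mul_le_mul_of_nonneg_left this hA.le
      have h3 : A * (1 - x / A + x / A * Real.exp A) = A - x + x * Real.exp A := by
        field_simp
      linarith
    have h2 : A * (Real.exp (-A) / (1 - Real.exp (-A))) ≤ x * (Real.exp (-x) / (1 - Real.exp (-x))) := by
      have e : ∀ z : ℝ, 0 < z → Real.exp (-z) / (1 - Real.exp (-z)) = 1 / (Real.exp z - 1) := by
        intro z hz
        have h5 : 1 < Real.exp z := Real.one_lt_exp_iff.mpr hz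
        rw [Real.exp_neg]
        have h6 : Real.exp z - 1 ≠ 0 := by linarith
        have h7 := (Real.exp_pos z).ne'
        have h8 : 1 - (Real.exp z)⁻¹ = (Real.exp z - 1) / Real.exp z := by field_simp
        rw [h8]
        field_simp
      rw [e A hA, e x hpos, mul_one_div, mul_one_div, div_le_div_iff₀]
      · exact h1
      · linarith [Real.one_lt_exp_iff.mpr hA]
      · linarith [Real.one_lt_exp_iff.mpr hpos]
    have h3 : capacity A / (1 - Real.exp (-A))
        = capacity A + capacity A * (Real.exp (-A) / (1 - Real.exp (-A))) := by
      have : 1 - Real.exp (-A) ≠ 0 := by linarith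
      field_simp
      ring
    have h4 : capacity A * (Real.exp (-A) / (1 - Real.exp (-A)))
        ≤ A * (Real.exp (-A) / (1 - Real.exp (-A))) :=
      mul_le_mul_of_nonneg_right (h.capacity_le hA) (div_nonneg hq0.le (by linarith))
    linarith

theorem supportLowerBound_le (h : IsCapacityAchieving A P) (hA : 0 < A) :
    supportLowerBound A ≤ (P.support.ncard : ℝ) := by
  have := h.1.1
  have hfin := h.finite_support hA
  have h1 : (1 : ℝ) = ∑ x ∈ hfin.toFinset, P.real {x} := by
    rw [sum_measureReal_singleton, Set.Finite.coe_toFinset]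
    have : P P.support = 1 := prob_compl_eq_zero_iff₀ Measure.nullMeasurableSet_support |>.mp
      Measure.measure_compl_support
    rw [measureReal_def, this, ENNReal.toReal_one]
  have h2 : ∑ x ∈ hfin.toFinset, P.real {x} ≤
      ∑ x ∈ hfin.toFinset, Real.exp (-(capacity A / (1 - Real.exp (-A)))) :=
    Finset.sum_le_sum fun x hx => h.measureReal_le hA (hfin.mem_toFinset.mp hx)
  rw [← h1, Finset.sum_const, nsmul_eq_mul, ← Set.ncard_eq_toFinset_card _ hfin, Real.exp_neg,
    ← div_eq_mul_inv, le_div_iff₀ (Real.exp_pos _), one_mul] at h2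
  exact h2

end IsCapacityAchieving

end PoissonChannel

end

noncomputable section

namespace PoissonChannel

open Topology

/-! ### The Lambert function -/

theorem hasDerivAt_mul_exp (y : ℝ) :
    HasDerivAt (fun y : ℝ => y * Real.exp y) ((1 + y) * Real.exp y) y := by
  convert! (hasDerivAt_id y).mul (Real.hasDerivAt_exp y) using 1
  simp only [id]
  ring

theorem continuous_mul_exp : Continuous fun y : ℝ => y * Real.exp y := by fun_prop

theorem strictMonoOn_mul_exp : StrictMonoOn (fun y : ℝ => y * Real.exp y) (Set.Ici (-1)) := by
  refine strictMonoOn_of_deriv_pos (convex_Ici _) continuous_mul_exp.continuousOn fun y hy => ?_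
  rw [interior_Ici] at hy
  rw [(hasDerivAt_mul_exp y).deriv]
  exact mul_pos (by linarith [Set.mem_Ioi.mp hy]) (Real.exp_pos _)

theorem strictAntiOn_mul_exp : StrictAntiOn (fun y : ℝ => y * Real.exp y) (Set.Iic (-1)) := by
  refine strictAntiOn_of_deriv_neg (convex_Iic _) continuous_mul_exp.continuousOn fun y hy => ?_
  rw [interior_Iic] at hy
  rw [(hasDerivAt_mul_exp y).deriv]
  exact mul_neg_of_neg_of_pos (by linarith [Set.mem_Iio.mp hy]) (Real.exp_pos _)

variable {A x : ℝ}

theorem lambertW0_spec (hA : Real.exp 1 ≤ A) :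
    -1 ≤ lambertW0 (-1 / A) ∧ lambertW0 (-1 / A) * Real.exp (lambertW0 (-1 / A)) = -1 / A := by
  have hA0 : 0 < A := (Real.exp_pos 1).trans_le hA
  have h1 : -1 / A ∈ (fun y : ℝ => y * Real.exp y) '' Set.Icc (-1) 0 := by
    refine intermediate_value_Icc (by norm_num) continuous_mul_exp.continuousOn ⟨?_, ?_⟩
    · rw [Real.exp_neg, neg_one_mul, neg_div, one_div]
      exact neg_le_neg (inv_anti₀ (Real.exp_pos 1) hA)
    · rw [zero_mul, neg_div]
      exact neg_nonpos.mpr (by positivity)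
  obtain ⟨y, hy, hy'⟩ := h1
  have h2 : ∃ z ∈ Set.Ici (-1 : ℝ), (fun y : ℝ => y * Real.exp y) z = -1 / A := ⟨y, hy.1, hy'⟩
  exact ⟨Function.invFunOn_mem h2, Function.invFunOn_eq h2⟩

/-- With s²/2 = log A - 1, the inequality e^s ≥ 1 + s + s²/2 reads e^s ≥ log A + s. This both
brackets the lower Lambert branch and gives the explicit square-root bound. -/
theorem neg_one_div_le_mul_exp (hA : Real.exp 1 ≤ A) :
    -1 / A ≤ (-Real.log A - Real.sqrt (2 * (Real.log A - 1))) *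
      Real.exp (-Real.log A - Real.sqrt (2 * (Real.log A - 1))) := by
  have hA0 : 0 < A := (Real.exp_pos 1).trans_le hA
  have hL : 1 ≤ Real.log A := (Real.le_log_iff_exp_le hA0).mpr hA
  set s := Real.sqrt (2 * (Real.log A - 1)) with hs
  have hs2 : s ^ 2 = 2 * (Real.log A - 1) := Real.sq_sqrt (by linarith)
  have h1 := Real.quadratic_le_exp_of_nonneg (Real.sqrt_nonneg (2 * (Real.log A - 1)))
  rw [← hs] at h1
  have h2 : Real.log A + s ≤ Real.exp s := by nlinarith
  rw [sub_eq_add_neg, Real.exp_add, Real.exp_neg, Real.exp_log hA0, Real.exp_neg s, neg_div,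
    show (-Real.log A + -s) * (A⁻¹ * (Real.exp s)⁻¹) = -((Real.log A + s) / Real.exp s / A) by
      field_simp; ring]
  refine neg_le_neg (div_le_div_of_nonneg_right ?_ hA0.le)
  rwa [div_le_one (Real.exp_pos _)]

theorem lambertWm1_spec (hA : Real.exp 1 ≤ A) :
    lambertWm1 (-1 / A) ≤ -1 ∧ lambertWm1 (-1 / A) * Real.exp (lambertWm1 (-1 / A)) = -1 / A := by
  have hA0 : 0 < A := (Real.exp_pos 1).trans_le hA
  have hL : 1 ≤ Real.log A := (Real.le_log_iff_exp_le hA0).mpr hA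
  have h1 : -1 / A ∈ (fun y : ℝ => y * Real.exp y) ''
      Set.Icc (-Real.log A - Real.sqrt (2 * (Real.log A - 1))) (-1) := by
    refine intermediate_value_Icc' (by linarith [Real.sqrt_nonneg (2 * (Real.log A - 1))])
      continuous_mul_exp.continuousOn ⟨?_, neg_one_div_le_mul_exp hA⟩
    rw [Real.exp_neg, neg_one_mul, neg_div, one_div]
    exact neg_le_neg (inv_anti₀ (Real.exp_pos 1) hA)
  obtain ⟨y, hy, hy'⟩ := h1
  have h2 : ∃ z ∈ Set.Iic (-1 : ℝ), (fun y : ℝ => y * Real.exp y) z = -1 / A := ⟨y, hy.2, hy'⟩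
  exact ⟨Function.invFunOn_mem h2, Function.invFunOn_eq h2⟩

theorem mul_log_div_le (hx : 0 < x) (hA : 0 < A) : x * Real.log (A / x) ≤ A / Real.exp 1 := by
  have h1 := Real.add_one_le_exp (Real.log (A / x) - 1)
  rw [sub_add_cancel, Real.exp_sub, Real.exp_log (by positivity)] at h1
  calc x * Real.log (A / x) ≤ x * (A / x / Real.exp 1) := by gcongr
    _ = _ := by field_simp

theorem exp_one_le_of_one_le_mul_log (hx : 0 < x) (hA : 0 < A) (h : 1 ≤ x * Real.log (A / x)) :
    Real.exp 1 ≤ A := by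
  have := h.trans (mul_log_div_le hx hA)
  rwa [le_div_iff₀ (Real.exp_pos 1), one_mul] at this

/-- The inequality `1 ≤ x * log (A / x)` in terms of the two branches of the Lambert function. -/
theorem lambert_bounds (hx : 0 < x) (hA : 0 < A) (h : 1 ≤ x * Real.log (A / x)) :
    Real.exp (-Real.sqrt (2 * (Real.log A - 1))) ≤ A * Real.exp (lambertWm1 (-1 / A)) ∧
    A * Real.exp (lambertWm1 (-1 / A)) ≤ x ∧ x ≤ A * Real.exp (lambertW0 (-1 / A)) ∧
    A * Real.exp (lambertW0 (-1 / A)) ≤ A - 1 := by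
  have hAe := exp_one_le_of_one_le_mul_log hx hA h
  have hL : 1 ≤ Real.log A := (Real.le_log_iff_exp_le hA).mpr hAe
  obtain ⟨hw, hw'⟩ := lambertW0_spec hAe
  obtain ⟨hv, hv'⟩ := lambertWm1_spec hAe
  set w := lambertW0 (-1 / A)
  set v := lambertWm1 (-1 / A)
  -- In this variable the hypothesis reads t e^t ≤ -1/A, and monotonicity of y e^y on each side of
  -- -1 traps t between the branches. At the upper branch there is equality, so the bound A - 1
  -- applies there too.
  set t := Real.log (x / A) with ht
  have hxt : x = A * Real.exp t := by rw [ht, Real.exp_log (by positivity)]; field_simp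
  have ht' : t * Real.exp t ≤ -1 / A := by
    have h1 : Real.log (A / x) = -t := by rw [ht, ← Real.log_inv, inv_div]
    rw [h1, hxt] at h
    rw [le_div_iff₀ hA]
    linarith
  refine ⟨?_, ?_, ?_, ?_⟩
  · have h1 : -Real.log A - Real.sqrt (2 * (Real.log A - 1)) ≤ v := by
      by_contra! hlt
      have h2 := strictAntiOn_mul_exp hv
        (show _ ≤ (-1 : ℝ) by linarith [Real.sqrt_nonneg (2 * (Real.log A - 1))]) hlt
      have h3 := neg_one_div_le_mul_exp hAe
      simp only at h2
      linarith
    calc Real.exp (-Real.sqrt (2 * (Real.log A - 1)))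
        = A * Real.exp (-Real.log A - Real.sqrt (2 * (Real.log A - 1))) := by
          rw [sub_eq_add_neg (-Real.log A), Real.exp_add, Real.exp_neg (Real.log A), Real.exp_log hA]
          field_simp
      _ ≤ _ := by gcongr
  · rw [hxt]
    gcongr
    by_contra! hlt
    have h2 := strictAntiOn_mul_exp (show t ≤ (-1 : ℝ) by linarith) hv hlt
    simp only at h2
    linarith
  · rw [hxt]
    gcongr
    by_contra! hlt
    have h2 := strictMonoOn_mul_exp hw (show (-1 : ℝ) ≤ t by linarith) hlt
    simp only at h2
    linarith
  · refine le_sub_one_of_one_le_mul_log (by positivity) hA ?_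
    rw [show A / (A * Real.exp w) = Real.exp (-w) by rw [Real.exp_neg]; field_simp, Real.log_exp]
    have : A * Real.exp w * -w = -(A * (w * Real.exp w)) := by ring
    rw [this, hw']
    field_simp
    norm_num

/-! ### A lower bound on the probability of the largest support point -/

variable {P : Measure ℝ}

/-- The posterior probability of the input `A` given the output `y`. -/
def postRight (A : ℝ) (P : Measure ℝ) (y : ℕ) : ℝ :=
  P.real {A} * (A ^ y * Real.exp (-A)) / mom P y

theorem postRight_nonneg (h : IsInput A P) (y : ℕ) : 0 ≤ postRight A P y :=
  div_nonneg (mul_nonneg measureReal_nonneg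
    (mul_nonneg (pow_nonneg h.nonneg _) (Real.exp_pos _).le)) (mom_nonneg h y)

theorem postRight_mono (h : IsInput A P) (hP : ¬ ∀ᵐ x ∂P, x = 0) : Monotone (postRight A P) := by
  refine monotone_nat_of_le_succ fun y => ?_
  rw [postRight, postRight, div_le_div_iff₀ (mom_pos h hP _) (mom_pos h hP _)]
  have h1 := condMean_le h hP y
  rw [condMean, div_le_iff₀ (mom_pos h hP _)] at h1
  have h2 : 0 ≤ P.real {A} * (A ^ y * Real.exp (-A)) :=
    mul_nonneg measureReal_nonneg (mul_nonneg (pow_nonneg h.nonneg _) (Real.exp_pos _).le)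
  calc P.real {A} * (A ^ y * Real.exp (-A)) * mom P (y + 1)
      ≤ P.real {A} * (A ^ y * Real.exp (-A)) * (A * mom P y) := by gcongr
    _ = _ := by ring

/-- Given the output, the input is A with the posterior probability and otherwise at most b. -/
theorem condMean_le_of_gap (h : IsInput A P) (hP : ¬ ∀ᵐ x ∂P, x = 0) {b : ℝ}
    (hb : ∀ᵐ x ∂P, x ≤ b ∨ x = A) (y : ℕ) : condMean P y ≤ b + (A - b) * postRight A P y := by
  have := h.1
  have hm := mom_pos h hP y
  have h1 : mom P (y + 1) - b * mom P y ≤ (A - b) * (P.real {A} * (A ^ y * Real.exp (-A))) := by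
    have e : (A - b) * (P.real {A} * (A ^ y * Real.exp (-A)))
        = ∫ x, ({A} : Set ℝ).indicator (fun _ => (A - b) * (A ^ y * Real.exp (-A))) x ∂P := by
      rw [integral_indicator (measurableSet_singleton A), setIntegral_const, smul_eq_mul]
      ring
    rw [mom_succ_sub h, e]
    refine integral_mono_ae (h.integrable (by fun_prop))
      ((integrable_const _).indicator (measurableSet_singleton A)) ?_
    filter_upwards [h.2, hb] with x hx hxb
    by_cases hxA : x = A
    · simp [hxA]
    · rw [Set.indicator_of_notMem (by simpa using hxA)]
      exact mul_nonpos_of_nonpos_of_nonneg (by linarith [hxb.resolve_right hxA])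
        (mul_nonneg (pow_nonneg hx.1 _) (Real.exp_pos _).le)
  rw [condMean, postRight, div_le_iff₀ hm, add_mul, mul_assoc (A - b), div_mul_cancel₀ _ hm.ne']
  linarith

/-- At the largest interior point b, the second-order condition needs E log g(Y+1) to exceed log b
by 1/b. Outputs beyond n are too rare to provide this, so the posterior of A must already matter at
n. -/
theorem IsCapacityAchieving.one_le_two_mul_postRight (h : IsCapacityAchieving A P) {b : ℝ}
    (hb0 : 0 < b) (hbA : b < A) (hb : IsGreatest (P.support \ {0, A}) b) {n : ℕ}
    (hn : A * (Real.exp 1 - 1) + Real.log (2 * A) - 1 ≤ n) :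
    1 ≤ 2 * (A * postRight A P n) := by
  have hA := hb0.trans hbA
  have hP := h.not_ae_eq hA 0
  have hgap : ∀ᵐ x ∂P, x ≤ b ∨ x = A := by
    filter_upwards [Measure.support_mem_ae (μ := P)] with x hx
    by_cases hxA : x = A
    · exact Or.inr hxA
    · by_cases hx0 : x = 0
      · exact Or.inl (hx0 ▸ hb0.le)
      · exact Or.inl (hb.2 ⟨hx, by simp [hx0, hxA]⟩)
  have hτ := postRight_nonneg h.1 n
  set τ := postRight A P n
  set K := (A - b) / b * τ
  have hK : 0 ≤ K := mul_nonneg (div_nonneg (by linarith) hb0.le) hτ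
  have hlogAb : 0 ≤ Real.log (A / b) := Real.log_nonneg ((one_le_div hb0).mpr hbA.le)
  -- Below n the monotone posterior and log t ≤ t - 1 give the excess K. From n on, the excess
  -- log(A/b) is multiplied by e^(y-n) ≥ 1, a Chernoff bound computable by the Poisson generating
  -- function.
  have hpt : ∀ y, Real.log (condMean P (y + 1)) ≤
      (Real.log b + K) + Real.log (A / b) * Real.exp (-n) * Real.exp 1 ^ y := by
    intro y
    rw [mul_assoc, ← Real.exp_one_rpow, ← Real.rpow_natCast, Real.exp_one_rpow, Real.exp_one_rpow,
      ← Real.exp_add]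
    rcases lt_or_ge y n with hy | hy
    · have h1 := condMean_le_of_gap h.1 hP hgap (y + 1)
      have h2 : postRight A P (y + 1) ≤ τ := postRight_mono h.1 hP hy
      have h3 := Real.log_le_sub_one_of_pos (div_pos (condMean_pos h.1 hP (y + 1)) hb0)
      rw [Real.log_div (condMean_pos h.1 hP _).ne' hb0.ne'] at h3
      have h4 : condMean P (y + 1) / b - 1 ≤ K := by
        have h5 : condMean P (y + 1) ≤ b + (A - b) * τ :=
          h1.trans (by have := mul_le_mul_of_nonneg_left h2 (sub_nonneg.mpr hbA.le); linarith)
        have h6 : K = (b + (A - b) * τ) / b - 1 := by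
          simp only [K]
          field_simp
          ring
        rw [h6]
        gcongr
      have h7 : 0 ≤ Real.log (A / b) * Real.exp (-n + y) := by positivity
      linarith
    · have h1 := Real.log_le_log (condMean_pos h.1 hP (y + 1)) (condMean_le h.1 hP (y + 1))
      have h2 : 1 ≤ Real.exp (-n + y) := by
        rw [Real.one_le_exp_iff]
        have : (n : ℝ) ≤ y := by exact_mod_cast hy
        linarith
      have h3 : Real.log (A / b) * 1 ≤ Real.log (A / b) * Real.exp (-n + y) := by gcongr
      rw [mul_one, Real.log_div hA.ne' hb0.ne'] at h3
      rw [Real.log_div hA.ne' hb0.ne']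
      linarith
  have g : ExpGrowth fun y => Real.log (A / b) * Real.exp (-n) * Real.exp 1 ^ y :=
    (ExpGrowth.const _).mul (ExpGrowth.pow _)
  have h1 := (h.infoDeriv_eq_zero_and_le hb.1.1 hb0 hbA).2.trans
    (poissonExp_mono (expGrowth_log_condMean h.1 hP).shift ((ExpGrowth.const _).add g) hb0.le hpt)
  rw [poissonExp_add (ExpGrowth.const _) g, poissonExp_const, poissonExp_const_mul,
    poissonExp_pow, mul_assoc, ← Real.exp_add] at h1
  have h2 : b⁻¹ ≤ K + Real.log (A / b) * Real.exp (-n + b * (Real.exp 1 - 1)) := by linarith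
  have h3 := mul_le_mul_of_nonneg_left h2 hb0.le
  rw [mul_inv_cancel₀ hb0.ne', mul_add, ← mul_assoc, ← mul_assoc] at h3
  have h4 : b * ((A - b) / b) * τ ≤ A * τ := by
    rw [mul_div_cancel₀ _ hb0.ne']
    gcongr
    linarith
  -- The threshold on n is chosen so that the exponential is at most e/(2A), against the maximum A/e
  -- of x log(A/x).
  have h5 : b * Real.log (A / b) * Real.exp (-n + b * (Real.exp 1 - 1)) ≤ 1 / 2 := by
    have he : 0 ≤ Real.exp 1 - 1 := by linarith [Real.add_one_le_exp 1]
    calc b * Real.log (A / b) * Real.exp (-n + b * (Real.exp 1 - 1))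
        ≤ A / Real.exp 1 * Real.exp (1 - Real.log (2 * A)) := by
          gcongr
          · exact mul_log_div_le hb0 hA
          · have := mul_le_mul_of_nonneg_right hbA.le he
            linarith
      _ = 1 / 2 := by
          rw [Real.exp_sub, Real.exp_log (by positivity)]
          field_simp
  linarith

/-- For x ≤ 1 the lower bound on x suffices; for x > 1, n log x ≥ x log x ≥ x - 1. -/
theorem exp_le_pow_mul_exp {s : ℝ} (hs : 0 ≤ s) {n : ℕ} (hx : Real.exp (-s) ≤ x) (hxn : x ≤ n) :
    Real.exp (-(s * n) - 1) ≤ x ^ n * Real.exp (-x) := by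
  have hx0 : 0 < x := (Real.exp_pos _).trans_le hx
  rw [← Real.exp_log hx0, ← Real.exp_nat_mul, ← Real.exp_add, Real.exp_log hx0, Real.exp_le_exp]
  have h1 : -s ≤ Real.log x := (Real.le_log_iff_exp_le hx0).mpr hx
  have hn : (0 : ℝ) ≤ n := hx0.le.trans hxn
  rcases le_or_gt x 1 with h | h
  · nlinarith
  · have h2 := Real.one_sub_inv_le_log_of_pos hx0
    have h3 : x * Real.log x ≤ n * Real.log x := by
      gcongr
      exact Real.log_nonneg h.le
    have h4 := mul_le_mul_of_nonneg_left h2 hx0.le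
    rw [mul_sub, mul_inv_cancel₀ hx0.ne'] at h4
    nlinarith [mul_nonneg hs hn]

theorem exponent_le (hA : Real.exp 1 ≤ A) {n : ℝ} (hn0 : 0 ≤ n)
    (hn : n ≤ A * (Real.exp 1 - 1) + Real.log (2 * A)) :
    Real.sqrt (2 * (Real.log A - 1)) * n + (n + 1) * Real.log A + A
      ≤ 2 * A * Real.exp 1 * Real.log A * Real.log A + 2 * Real.log A := by
  have hA0 : 0 < A := (Real.exp_pos 1).trans_le hA
  have hL : 1 ≤ Real.log A := (Real.le_log_iff_exp_le hA0).mpr hA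
  rw [Real.log_mul (by norm_num) hA0.ne'] at hn
  have hLA := mul_log_div_le one_pos hA0
  rw [one_mul, div_one, le_div_iff₀ (Real.exp_pos 1)] at hLA
  set L := Real.log A
  have he1 := Real.exp_one_gt_d9
  have he2 := Real.exp_one_lt_d9
  have hlog2 := Real.log_two_lt_d9
  -- The difference of the squares is (L - 3/2)².
  have hs : Real.sqrt (2 * (L - 1)) ≤ L - 1 / 2 := by
    rw [Real.sqrt_le_left (by linarith)]
    nlinarith [sq_nonneg (L - 3 / 2)]
  have hn1 : n ≤ 1.719 * A + L + 0.7 := by nlinarith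
  have h1 : Real.sqrt (2 * (L - 1)) * n ≤ (L - 1 / 2) * n := by gcongr
  have h2 : n * (2 * L - 1 / 2) ≤ (1.719 * A + L + 0.7) * (2 * L - 1 / 2) := by
    gcongr
    linarith
  have h3 : 5.436 * (A * L) ≤ 2 * A * Real.exp 1 * L * L := by
    have h4 : A * L ≤ A * L * L := le_mul_of_one_le_right (by positivity) hL
    have h5 : 0 ≤ A * L * L := by positivity
    nlinarith
  have h6 : 2.718 * L ≤ A := by nlinarith
  have h7 : 2.718 * L * L ≤ A * L := by gcongr
  nlinarith

namespace IsCapacityAchieving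

theorem interior_nonempty (h : IsCapacityAchieving A P) (hA : 0 < A)
    (hB : 4 ≤ supportLowerBound A) : (P.support \ {0, A}).Nonempty := by
  by_contra hne
  rw [Set.not_nonempty_iff_eq_empty, Set.sdiff_eq_empty] at hne
  have h1 := hB.trans (h.supportLowerBound_le hA)
  have h2 : P.support.ncard ≤ 2 := by
    refine (Set.ncard_le_ncard hne).trans ?_
    exact (Set.ncard_insert_le _ _).trans (by simp)
  have h3 : (P.support.ncard : ℝ) ≤ 2 := by exact_mod_cast h2
  linarith

theorem le_measureReal_interior (h : IsCapacityAchieving A P) (hA : 0 < A) :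
    1 - 2 * Real.exp (-(capacity A / (1 - Real.exp (-A)))) ≤ P.real (P.support \ {0, A}) := by
  have := h.1.1
  have h0 := h.measureReal_le hA (h.zero_mem_support hA)
  have h1 := h.measureReal_le hA (h.right_mem_support hA)
  have h2 : P.real P.support = 1 := by
    have : P P.support = 1 := prob_compl_eq_zero_iff₀ Measure.nullMeasurableSet_support |>.mp
      Measure.measure_compl_support
    rw [measureReal_def, this, ENNReal.toReal_one]
  have h3 : P.real P.support ≤ P.real (P.support \ {0, A}) + (P.real {0} + P.real {A}) := by
    refine (measureReal_mono (s₂ := (P.support \ {0, A}) ∪ ({0} ∪ {A})) ?_).trans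
      ((measureReal_union_le _ _).trans (by gcongr; exact measureReal_union_le _ _))
    intro z hz
    by_cases hz' : z ∈ ({0, A} : Set ℝ)
    · exact Or.inr hz'
    · exact Or.inl ⟨hz, hz'⟩
  linarith

theorem le_measureReal_right (h : IsCapacityAchieving A P) (hA : 0 < A)
    (hB : 4 ≤ supportLowerBound A) :
    (1 - 3 * Real.exp (-(capacity A / (1 - Real.exp (-A))))) /
      (2 * A ^ (2 * A * Real.exp 1 * Real.log A + 2) * Real.exp (-2 * A + 1)) ≤ P.real {A} := by
  have := h.1.1
  have hP := h.not_ae_eq hA 0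
  obtain ⟨b, hb⟩ : ∃ b, IsGreatest (P.support \ {0, A}) b := by
    have hfin := h.finite_interior hA
    obtain ⟨b, hb, hb'⟩ := Set.exists_max_image _ id hfin (h.interior_nonempty hA hB)
    exact ⟨b, hb, fun x hx => hb' x hx⟩
  obtain ⟨hb0, hbA⟩ := h.mem_Ioo_of_mem_support hb.1
  have hAe := exp_one_le_of_one_le_mul_log hb0 hA (h.one_le_mul_log hb.1.1 hb0 hbA)
  have hL : 1 ≤ Real.log A := (Real.le_log_iff_exp_le hA).mpr hAe
  set B := Real.exp (-(capacity A / (1 - Real.exp (-A)))) with hBdef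
  have hB4 : B ≤ 1 / 4 := by
    rw [hBdef, Real.exp_neg, one_div]
    exact inv_anti₀ (by norm_num) hB
  have hB0 : 0 < B := Real.exp_pos _
  set s := Real.sqrt (2 * (Real.log A - 1)) with hs
  have hs0 : 0 ≤ s := Real.sqrt_nonneg _
  set r := A * (Real.exp 1 - 1) + Real.log (2 * A) - 1 with hr
  have he1 := Real.exp_one_gt_d9
  have hr0 : A ≤ r + 1 ∧ 0 ≤ r := by
    have h2 : 1 ≤ Real.log (2 * A) := by
      rw [Real.log_mul (by norm_num) hA.ne']
      linarith [Real.log_nonneg (show (1 : ℝ) ≤ 2 by norm_num)]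
    constructor <;> nlinarith
  set n := ⌈r⌉₊ with hn
  have hn1 : r ≤ n := Nat.le_ceil r
  have hn2 : (n : ℝ) ≤ r + 1 := (Nat.ceil_lt_add_one hr0.2).le
  have hAn : A - 1 ≤ n := by linarith [hr0.1]
  have hτ := h.one_le_two_mul_postRight hb0 hbA hb hn1
  -- Interior points carry mass at least 1 - 2B and lie between e^(-s) and A - 1 ≤ n. Since `hτ`
  -- bounds m(n) above by 2A·P(A) A^n e^(-A), this can be solved for P(A).
  have hmom : (1 - 3 * B) * Real.exp (-(s * n) - 1) ≤ mom P n := by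
    refine le_trans ?_ (measureReal_mul_le_mom h.1 (s := P.support \ {0, A})
      (c := Real.exp (-(s * n) - 1))
      (h.finite_interior hA).measurableSet.nullMeasurableSet (ae_of_all _ fun x hx => ?_))
    · gcongr
      linarith [h.le_measureReal_interior hA]
    · obtain ⟨hx0, hxA⟩ := h.mem_Ioo_of_mem_support hx
      obtain ⟨h1, h2, -, -⟩ := lambert_bounds hx0 hA (h.one_le_mul_log hx.1 hx0 hxA)
      exact exp_le_pow_mul_exp hs0 (h1.trans h2) ((le_sub_one_of_one_le_mul_log hx0 hA
        (h.one_le_mul_log hx.1 hx0 hxA)).trans hAn)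
  have hm0 := mom_pos h.1 hP n
  rw [postRight, ← mul_div_assoc, ← mul_div_assoc, le_div_iff₀ hm0, one_mul] at hτ
  have h1 := hmom.trans hτ
  have h2 := exponent_le hAe (Nat.cast_nonneg n) (by linarith)
  rw [← hs] at h2
  have e1 : A * (P.real {A} * (A ^ n * Real.exp (-A)))
      = P.real {A} * Real.exp ((n + 1) * Real.log A - A) := by
    rw [Real.exp_sub, add_mul, Real.exp_add, Real.exp_nat_mul, one_mul, Real.exp_log hA,
      Real.exp_neg]
    field_simp
  have e2 : 2 * A ^ (2 * A * Real.exp 1 * Real.log A + 2) * Real.exp (-2 * A + 1)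
      = 2 * Real.exp ((2 * A * Real.exp 1 * Real.log A + 2) * Real.log A + (-2 * A + 1)) := by
    rw [Real.rpow_def_of_pos hA, mul_comm (Real.log A), mul_assoc, ← Real.exp_add]
  rw [e1] at h1
  rw [e2, div_le_iff₀ (by positivity)]
  have h3 : (1 - 3 * B) ≤ 2 * P.real {A} *
      (Real.exp ((n + 1) * Real.log A - A) * Real.exp (s * n + 1)) := by
    have e3 : Real.exp (-(s * n) - 1) * Real.exp (s * n + 1) = 1 := by
      rw [← Real.exp_add]; simp
    have := mul_le_mul_of_nonneg_right h1 (Real.exp_pos (s * n + 1)).le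
    rw [mul_assoc, e3, mul_one] at this
    linarith
  refine h3.trans ?_
  rw [← Real.exp_add, ← mul_assoc, mul_comm (P.real {A}) 2]
  refine mul_le_mul_of_nonneg_left (Real.exp_le_exp.mpr ?_) (by positivity)
  linarith

theorem ncard_support_le_supportUpperBound (h : IsCapacityAchieving A P) (hA : 0 < A)
    (hB : 4 ≤ supportLowerBound A) : (P.support.ncard : ℝ) ≤ supportUpperBound A := by
  have := h.1.1
  have h1 := h.le_measureReal_right hA hB
  have h2 := h.ncard_support_le hA
  set B := Real.exp (-(capacity A / (1 - Real.exp (-A)))) with hBdef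
  have hB4 : B ≤ 1 / 4 := by
    rw [hBdef, Real.exp_neg, one_div]
    exact inv_anti₀ (by norm_num) hB
  have h3 : 0 < (1 - 3 * B) / 2 := by linarith
  have e : (1 - 3 * B) / (2 * A ^ (2 * A * Real.exp 1 * Real.log A + 2) * Real.exp (-2 * A + 1))
      = (1 - 3 * B) / 2 / (A ^ (2 * A * Real.exp 1 * Real.log A + 2) * Real.exp (-2 * A + 1)) := by
    rw [mul_assoc, div_div]
  rw [e] at h1
  have h4 := Real.log_le_log (by positivity) h1
  rw [Real.log_div h3.ne' (by positivity), Real.log_mul (by positivity) (by positivity),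
    Real.log_rpow hA, Real.log_exp] at h4
  have h5 : (P.support.ncard : ℝ) ≤ ⌈A - Real.log (P.real {A}) - capacity A⌉ + 2 := by
    exact_mod_cast h2
  have h6 := Int.ceil_lt_add_one (A - Real.log (P.real {A}) - capacity A)
  -- The constant 4 collects 2 for the endpoints, 1 for the ceiling and 1 from the factor e^(-2A+1).
  rw [supportUpperBound, ← hBdef]
  nlinarith

end IsCapacityAchieving

end PoissonChannel

end

noncomputable section

namespace PoissonChannel

open Topology

/-! ### The growth of the capacity -/

/-- The uniform law on the first `n` positive squares. -/
def unifSquares (n : ℕ) : Measure ℝ :=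
  ∑ k ∈ Finset.range n, ENNReal.ofReal (1 / n) • Measure.dirac (((k : ℝ) + 1) ^ 2)

theorem isInput_unifSquares {n : ℕ} (hn : 0 < n) : IsInput ((n : ℝ) ^ 2) (unifSquares n) := by
  constructor
  · constructor
    simp only [unifSquares, Measure.coe_finsetSum, Finset.sum_apply, Measure.smul_apply,
      measure_univ, smul_eq_mul, mul_one, Finset.sum_const, Finset.card_range, nsmul_eq_mul]
    rw [← ENNReal.ofReal_natCast, ← ENNReal.ofReal_mul (by positivity)]
    field_simp
    simp
  · rw [unifSquares, ← Measure.sum_coe_finset, Measure.ae_sum_iff]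
    intro k
    refine Measure.ae_smul_measure ?_ _
    rw [ae_dirac_eq]
    have hk : (((k : ℕ) : ℝ) + 1) ≤ n := by exact_mod_cast Finset.mem_range.mp k.2
    exact ⟨by positivity, by gcongr⟩

theorem integral_unifSquares (n : ℕ) (f : ℝ → ℝ) :
    ∫ x, f x ∂(unifSquares n) = ∑ k ∈ Finset.range n, 1 / (n : ℝ) * f (((k : ℝ) + 1) ^ 2) := by
  rw [unifSquares, integral_finsetSum_measure fun k _ =>
    (integrable_dirac (by simp)).smul_measure ENNReal.ofReal_ne_top]
  refine Finset.sum_congr rfl fun k _ => ?_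
  rw [integral_smul_measure, integral_dirac, ENNReal.toReal_ofReal (by positivity), smul_eq_mul]

theorem mom_unifSquares (n y : ℕ) : mom (unifSquares n) y = ∑ k ∈ Finset.range n, 1 / (n : ℝ) *
    Real.exp (2 * Real.log ((k : ℝ) + 1) * y - ((k : ℝ) + 1) ^ 2) := by
  rw [mom, integral_unifSquares n]
  refine Finset.sum_congr rfl fun k _ => ?_
  rw [sub_eq_add_neg, Real.exp_add, mul_comm _ (y : ℝ), Real.exp_nat_mul, mul_comm 2,
    Real.exp_mul, Real.exp_log (by positivity), Real.rpow_two]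

theorem sum_pow_half_le {ι : Type*} (s : Finset ι) (g : ι → ℕ) (hg : Set.InjOn g s) :
    ∑ i ∈ s, (1 / 2 : ℝ) ^ g i ≤ 2 := by
  rw [← Finset.sum_image (f := fun m => (1 / 2 : ℝ) ^ m) hg]
  exact (summable_geometric_two.sum_le_tsum _ fun _ _ => by positivity).trans_eq tsum_geometric_two

theorem exp_neg_sq_le {t : ℝ} {m : ℕ} (h : (m : ℝ) ≤ |t|) : Real.exp (-t ^ 2) ≤ (1 / 2 : ℝ) ^ m := by
  have h1 : (m : ℝ) ≤ t ^ 2 := by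
    have h2 : (m : ℝ) ^ 2 ≤ t ^ 2 := by rw [← sq_abs t]; gcongr
    have h3 : (m : ℝ) ≤ (m : ℝ) ^ 2 := by exact_mod_cast Nat.le_self_pow (by norm_num) m
    linarith
  calc Real.exp (-t ^ 2) ≤ Real.exp (m * (-1)) := Real.exp_le_exp.mpr (by linarith)
    _ = Real.exp (-1) ^ m := Real.exp_nat_mul _ _
    _ ≤ _ := by
      gcongr
      rw [Real.exp_neg, one_div]
      exact inv_anti₀ (by norm_num) (by linarith [Real.add_one_le_exp 1])

/-- Split at ⌊v⌋: on each side the distances to v dominate distinct integers, so each half is below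
a geometric series of sum 2. -/
theorem sum_exp_neg_sq_le (n : ℕ) {v : ℝ} (hv : 0 ≤ v) :
    ∑ k ∈ Finset.range n, Real.exp (-((k : ℝ) + 1 - v) ^ 2) ≤ 4 := by
  have hN := Nat.floor_le hv
  have hN' := Nat.lt_floor_add_one v
  set N := ⌊v⌋₊
  rw [← Finset.sum_filter_add_sum_filter_not _ (fun k => k + 1 ≤ N)]
  have h1 : ∑ k ∈ Finset.range n with k + 1 ≤ N, Real.exp (-((k : ℝ) + 1 - v) ^ 2) ≤
      ∑ k ∈ Finset.range n with k + 1 ≤ N, (1 / 2 : ℝ) ^ (N - (k + 1)) := by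
    refine Finset.sum_le_sum fun k hk => exp_neg_sq_le ?_
    have hk' := (Finset.mem_filter.mp hk).2
    rw [Nat.cast_sub hk', abs_sub_comm]
    push_cast
    exact le_trans (by linarith) (le_abs_self _)
  have h2 : ∑ k ∈ Finset.range n with ¬ (k + 1 ≤ N), Real.exp (-((k : ℝ) + 1 - v) ^ 2) ≤
      ∑ k ∈ Finset.range n with ¬ (k + 1 ≤ N), (1 / 2 : ℝ) ^ (k - N) := by
    refine Finset.sum_le_sum fun k hk => exp_neg_sq_le ?_
    have hk' := (Finset.mem_filter.mp hk).2
    rw [Nat.cast_sub (by omega)]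
    exact le_trans (by linarith) (le_abs_self _)
  have h3 := sum_pow_half_le (Finset.filter (fun k => k + 1 ≤ N) (Finset.range n))
    (fun k => N - (k + 1)) (by
      intro a ha b hb hab
      simp only [Finset.coe_filter, Set.mem_ofPred_eq] at ha hb hab
      omega)
  have h4 := sum_pow_half_le (Finset.filter (fun k => ¬ (k + 1 ≤ N)) (Finset.range n))
    (fun k => k - N) (by
      intro a ha b hb hab
      simp only [Finset.coe_filter, Set.mem_ofPred_eq] at ha hb hab
      omega)
  linarith

/-- The left side is the divergence of the Poisson law of mean u² from that of mean j²: neighbouring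
squares are boundedly distinguishable. -/
theorem mul_log_sub_le {u j : ℝ} (hu : 0 ≤ u) (h1 : u ≤ j) (h2 : j ≤ u + 1) :
    u ^ 2 * Real.log (u ^ 2) - u ^ 2 - (2 * Real.log j * u ^ 2 - j ^ 2) ≤ 3 := by
  rcases hu.eq_or_lt with rfl | hu
  · norm_num
    nlinarith
  have hj : 0 < j := hu.trans_le h1
  have h3 := Real.one_sub_inv_le_log_of_pos (div_pos hj hu)
  rw [Real.log_div hj.ne' hu.ne', inv_div] at h3
  have h4 := mul_le_mul_of_nonneg_left h3 (show 0 ≤ 2 * u ^ 2 by positivity)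
  have h5 : j ^ 2 - u ^ 2 - 2 * u ^ 2 * (1 - u / j) = (j - u) ^ 2 * ((j + 2 * u) / j) := by
    field_simp
    ring
  have h6 : (j + 2 * u) / j ≤ 3 := by rw [div_le_iff₀ hj]; linarith
  have h7 : (j - u) ^ 2 ≤ 1 := by nlinarith
  have h8 : (j - u) ^ 2 * ((j + 2 * u) / j) ≤ 1 * 3 := by gcongr
  rw [Real.log_pow]
  push_cast
  nlinarith

/-- For v = √y this compares the Poisson weight of mean j² at y with its maximum over means, with a
Gaussian loss in j - √y. -/
theorem mul_log_sub_le_mul_log {j v : ℝ} (hj : 0 < j) (hv : 0 ≤ v) :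
    2 * Real.log j * v ^ 2 - j ^ 2 ≤ v ^ 2 * Real.log (v ^ 2) - v ^ 2 - (j - v) ^ 2 := by
  rcases hv.eq_or_lt with rfl | hv
  · simp
  have h3 := Real.log_le_sub_one_of_pos (div_pos hj hv)
  rw [Real.log_div hj.ne' hv.ne'] at h3
  have h4 := mul_le_mul_of_nonneg_left h3 (show 0 ≤ 2 * v ^ 2 by positivity)
  have h5 : 2 * v ^ 2 * (j / v - 1) = 2 * v * j - 2 * v ^ 2 := by field_simp
  rw [Real.log_pow]
  push_cast
  nlinarith

theorem not_ae_eq_zero_unifSquares {n : ℕ} (hn : 0 < n) : ¬ ∀ᵐ x ∂(unifSquares n), x = 0 := by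
  intro h
  have h1 := mom_succ_of_ae_eq_zero h 0
  rw [mom_unifSquares] at h1
  have h2 : 0 < ∑ k ∈ Finset.range n, 1 / (n : ℝ) *
      Real.exp (2 * Real.log ((k : ℝ) + 1) * (0 + 1 : ℕ) - ((k : ℝ) + 1) ^ 2) :=
    Finset.sum_pos (fun k _ => by positivity) (Finset.nonempty_range_iff.mpr hn.ne')
  exact h2.ne' h1

variable {A : ℝ}

/-- Take the output law of n uniform squares as reference. It dominates 1/n times the Poisson law at
the next square above x, costing log n plus a bounded divergence. -/
theorem capacity_le_log (hA : 0 ≤ A) : capacity A ≤ Real.log (⌊Real.sqrt A⌋₊ + 1 : ℕ) + 3 := by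
  obtain ⟨P, h⟩ := exists_isCapacityAchieving hA
  have := h.1.1
  set n := ⌊Real.sqrt A⌋₊ + 1 with hn
  have hn0 : 0 < n := Nat.succ_pos _
  have hU := isInput_unifSquares hn0
  have hmpos := mom_pos hU (not_ae_eq_zero_unifSquares hn0)
  have hg := expGrowth_log_mom hU
  have hpt : ∀ x, 0 ≤ x → x ≤ A → infoDensity (mom (unifSquares n)) x ≤ Real.log n + 3 := by
    intro x hx hxA
    set k := ⌊Real.sqrt x⌋₊
    have hk : k < n := Nat.lt_succ_of_le (Nat.floor_mono (Real.sqrt_le_sqrt hxA))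
    have hk1 := Nat.floor_le (Real.sqrt_nonneg x)
    have hk2 := Nat.lt_floor_add_one (Real.sqrt x)
    have g1 : ExpGrowth fun y : ℕ => 2 * Real.log ((k : ℝ) + 1) * y :=
      (ExpGrowth.const _).mul ExpGrowth.natCast
    have h1 := poissonExp_mono (g1.add (ExpGrowth.const (-((k : ℝ) + 1) ^ 2 - Real.log n))) hg hx
      fun y => by
        have h2 : 1 / (n : ℝ) * Real.exp (2 * Real.log ((k : ℝ) + 1) * y - ((k : ℝ) + 1) ^ 2) ≤
            mom (unifSquares n) y := by
          rw [mom_unifSquares]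
          exact Finset.single_le_sum (f := fun k : ℕ => 1 / (n : ℝ) *
            Real.exp (2 * Real.log ((k : ℝ) + 1) * y - ((k : ℝ) + 1) ^ 2))
            (fun i _ => by positivity) (Finset.mem_range.mpr hk)
        have h3 := Real.log_le_log (by positivity) h2
        rw [Real.log_mul (by positivity) (by positivity), Real.log_exp, one_div, Real.log_inv] at h3
        linarith
    rw [poissonExp_add g1 (ExpGrowth.const _), poissonExp_const_mul, poissonExp_natCast,
      poissonExp_const] at h1
    have h4 := mul_log_sub_le (Real.sqrt_nonneg x) hk2.le (by linarith)
    rw [Real.sq_sqrt hx] at h4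
    rw [infoDensity]
    linarith
  have h1 := info_le_integral h.1 hg hmpos (hasSum_mom hU)
  have h2 := h.1.integral_mono (continuous_infoDensity hg)
    (continuous_const (y := Real.log n + 3)) hpt
  rw [h.info_eq] at h1
  simp only [integral_const, probReal_univ, one_smul] at h2
  exact h1.trans h2

/-- E[Y log Y] = x E log(Y+1) ≤ x log(x+1) ≤ x log x + 1; the middle step is Jensen, by the tangent
of log at x + 1. -/
theorem poissonExp_mul_log_le {x : ℝ} (hx : 0 ≤ x)
    (hg : ExpGrowth fun y : ℕ => Real.log ((y : ℝ) + 1)) :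
    poissonExp (fun y : ℕ => y * Real.log y) x ≤ x * Real.log x + 1 := by
  have hg' : ExpGrowth fun y : ℕ => Real.log (y : ℝ) := by
    refine ExpGrowth.unshift ?_
    simpa using hg
  rw [poissonExp_natCast_mul hg']
  have h1 := poissonExp_mono hg ((ExpGrowth.const (Real.log (x + 1) - x / (x + 1))).add
    ((ExpGrowth.const (1 / (x + 1))).mul ExpGrowth.natCast)) hx fun y => by
      have h2 := Real.log_le_sub_one_of_pos (show 0 < ((y : ℝ) + 1) / (x + 1) by positivity)
      rw [Real.log_div (by positivity) (by positivity)] at h2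
      have h3 : ((y : ℝ) + 1) / (x + 1) - 1 = 1 / (x + 1) * y - x / (x + 1) := by
        field_simp
        ring
      linarith
  rw [poissonExp_add (ExpGrowth.const _) ((ExpGrowth.const _).mul ExpGrowth.natCast),
    poissonExp_const_mul, poissonExp_natCast, poissonExp_const] at h1
  have h4 : poissonExp (fun y : ℕ => Real.log ((y : ℝ) + 1)) x ≤ Real.log (x + 1) := by
    refine h1.trans_eq ?_
    field_simp
    ring
  push_cast
  refine (mul_le_mul_of_nonneg_left h4 hx).trans ?_
  rcases hx.eq_or_lt with rfl | hx
  · simp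
  have h5 := Real.log_le_sub_one_of_pos (show 0 < (x + 1) / x by positivity)
  rw [Real.log_div (by positivity) hx.ne'] at h5
  have h6 := mul_le_mul_of_nonneg_left h5 hx.le
  have h7 : x * ((x + 1) / x - 1) = 1 := by field_simp; ring
  linarith

theorem expGrowth_log_natCast_add_one : ExpGrowth fun y : ℕ => Real.log ((y : ℝ) + 1) := by
  refine ExpGrowth.natCast.of_le fun y => ?_
  rw [abs_of_nonneg (Real.log_nonneg (by linarith [y.cast_nonneg (α := ℝ)])), Nat.abs_cast]
  linarith [Real.log_le_sub_one_of_pos (show 0 < (y : ℝ) + 1 by positivity)]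

/-- For uniform squares as input, the Gaussian sum gives m(y) ≤ (4/n) y^y e^(-y), so i(x) ≥ log n -
log 4 - 1 at every input. -/
theorem log_le_capacity (hA : 1 ≤ A) : Real.log ⌊Real.sqrt A⌋₊ - Real.log 4 - 1 ≤ capacity A := by
  have hsq : 1 ≤ Real.sqrt A := Real.one_le_sqrt.mpr hA
  have hn0 : 0 < ⌊Real.sqrt A⌋₊ := Nat.floor_pos.mpr hsq
  have hn1 := Nat.floor_le (Real.sqrt_nonneg A)
  set n := ⌊Real.sqrt A⌋₊ with hn
  have hU := isInput_unifSquares hn0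
  have := hU.1
  have hUA : IsInput A (unifSquares n) := hU.mono (by
    rw [← Real.sq_sqrt (zero_le_one.trans hA)]
    gcongr)
  have hmpos := mom_pos hU (not_ae_eq_zero_unifSquares hn0)
  have hg := expGrowth_log_mom hU
  have hg' : ExpGrowth fun y : ℕ => (y : ℝ) * Real.log y := by
    refine ExpGrowth.natCast.mul (ExpGrowth.unshift ?_)
    simpa using expGrowth_log_natCast_add_one
  have hlog : ∀ y, Real.log (mom (unifSquares n) y) ≤
      (y * Real.log y - y) + (Real.log 4 - Real.log n) := by
    intro y
    have h1 : mom (unifSquares n) y ≤ 4 / n * Real.exp (y * Real.log y - y) := by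
      rw [mom_unifSquares]
      calc ∑ k ∈ Finset.range n, 1 / (n : ℝ) *
            Real.exp (2 * Real.log ((k : ℝ) + 1) * y - ((k : ℝ) + 1) ^ 2)
          ≤ ∑ k ∈ Finset.range n, 1 / (n : ℝ) * (Real.exp (y * Real.log y - y) *
            Real.exp (-((k : ℝ) + 1 - Real.sqrt y) ^ 2)) := by
            refine Finset.sum_le_sum fun k _ => ?_
            rw [← Real.exp_add]
            gcongr
            have := mul_log_sub_le_mul_log (show 0 < (k : ℝ) + 1 by positivity)
              (Real.sqrt_nonneg (y : ℝ))
            rw [Real.sq_sqrt (Nat.cast_nonneg y)] at this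
            linarith
        _ = 1 / (n : ℝ) * Real.exp (y * Real.log y - y) *
            ∑ k ∈ Finset.range n, Real.exp (-((k : ℝ) + 1 - Real.sqrt y) ^ 2) := by
            rw [Finset.mul_sum]
            simp only [mul_assoc]
        _ ≤ 1 / (n : ℝ) * Real.exp (y * Real.log y - y) * 4 := by
            gcongr
            exact sum_exp_neg_sq_le n (Real.sqrt_nonneg _)
        _ = _ := by ring
    have h2 := Real.log_le_log (hmpos y) h1
    rw [Real.log_mul (by positivity) (by positivity), Real.log_exp,
      Real.log_div (by norm_num) (by positivity)] at h2
    linarith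
  have hpt : ∀ x, 0 ≤ x → x ≤ (n : ℝ) ^ 2 →
      Real.log n - Real.log 4 - 1 ≤ infoDensity (mom (unifSquares n)) x := by
    intro x hx _
    have h1 := poissonExp_mono hg ((hg'.sub ExpGrowth.natCast).add (ExpGrowth.const _)) hx hlog
    rw [poissonExp_add (hg'.sub ExpGrowth.natCast) (ExpGrowth.const _),
      poissonExp_sub hg' ExpGrowth.natCast, poissonExp_natCast, poissonExp_const] at h1
    have h2 := poissonExp_mul_log_le hx expGrowth_log_natCast_add_one
    rw [infoDensity]
    linarith
  have h2 := hU.integral_mono (continuous_const (y := Real.log n - Real.log 4 - 1))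
    (continuous_infoDensity hg) hpt
  simp only [integral_const, probReal_univ, one_smul] at h2
  exact h2.trans (info_le_capacity hUA)

theorem log_sqrt_sub_le_capacity (hA : 1 ≤ A) : Real.log (Real.sqrt A) - 4 ≤ capacity A := by
  have hsq : 1 ≤ Real.sqrt A := Real.one_le_sqrt.mpr hA
  have hn0 : 0 < ⌊Real.sqrt A⌋₊ := Nat.floor_pos.mpr hsq
  have h1 := log_le_capacity hA
  have h2 := Nat.lt_floor_add_one (Real.sqrt A)
  set n := ⌊Real.sqrt A⌋₊
  have hn1 : (1 : ℝ) ≤ n := by exact_mod_cast hn0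
  have h3 := Real.log_le_log (by positivity) (show Real.sqrt A ≤ 2 * n by linarith)
  rw [Real.log_mul (by norm_num) (by positivity)] at h3
  have h4 : Real.log 4 = 2 * Real.log 2 := by
    rw [show (4 : ℝ) = 2 ^ 2 by norm_num, Real.log_pow]; norm_num
  linarith [Real.log_two_lt_d9]

theorem capacity_le_log_sqrt_add (hA : 1 ≤ A) : capacity A ≤ Real.log (Real.sqrt A) + 4 := by
  have hsq : 1 ≤ Real.sqrt A := Real.one_le_sqrt.mpr hA
  have h1 := capacity_le_log (zero_le_one.trans hA)
  have h2 := Nat.floor_le (Real.sqrt_nonneg A)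
  push_cast at h1
  have h3 := Real.log_le_log (by positivity)
    (show (⌊Real.sqrt A⌋₊ : ℝ) + 1 ≤ 2 * Real.sqrt A by linarith)
  rw [Real.log_mul (by norm_num) (by positivity)] at h3
  linarith [Real.log_two_lt_d9]

/-! ### Asymptotic orders of the two bounds on the support size -/

theorem le_supportLowerBound (hA : 1 ≤ A) : Real.exp (-4) * Real.sqrt A ≤ supportLowerBound A := by
  have hA0 : 0 < A := by linarith
  have hq : Real.exp (-A) < 1 := Real.exp_lt_one_iff.mpr (by linarith)
  have h1 : capacity A ≤ capacity A / (1 - Real.exp (-A)) :=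
    le_div_self (capacity_nonneg A) (by linarith) (by linarith [Real.exp_pos (-A)])
  rw [← Real.exp_log (show 0 < Real.sqrt A by positivity), ← Real.exp_add, supportLowerBound,
    Real.exp_le_exp]
  linarith [log_sqrt_sub_le_capacity hA]

theorem supportLowerBound_le_sqrt (hA : 1 ≤ A) :
    supportLowerBound A ≤ Real.exp 5 * Real.sqrt A := by
  have hA0 : 0 < A := by linarith
  obtain ⟨P, h⟩ := exists_isCapacityAchieving hA0.le
  have hq : Real.exp (-A) < 1 := Real.exp_lt_one_iff.mpr (by linarith)
  -- Equivalent to (C + 1)e^(-A) ≤ 1, which follows from C ≤ A and A + 1 ≤ e^A.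
  have h1 : capacity A / (1 - Real.exp (-A)) ≤ capacity A + 1 := by
    have h2 : (A + 1) * Real.exp (-A) ≤ 1 := by
      rw [Real.exp_neg, ← div_eq_mul_inv, div_le_one (Real.exp_pos A)]
      exact Real.add_one_le_exp A
    have h3 : (capacity A + 1) * Real.exp (-A) ≤ (A + 1) * Real.exp (-A) := by
      gcongr
      exact h.capacity_le hA0
    rw [div_le_iff₀ (by linarith)]
    linarith
  rw [← Real.exp_log (show 0 < Real.sqrt A by positivity), ← Real.exp_add, supportLowerBound,
    Real.exp_le_exp]
  linarith [capacity_le_log_sqrt_add hA]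

theorem supportLowerBound_isTheta :
    supportLowerBound =Θ[atTop] (fun A : ℝ => Real.sqrt A) := by
  constructor
  · refine IsBigO.of_bound (Real.exp 5) ?_
    filter_upwards [eventually_ge_atTop 1] with A hA
    rw [Real.norm_of_nonneg (show 0 ≤ supportLowerBound A from (Real.exp_pos _).le),
      Real.norm_of_nonneg (Real.sqrt_nonneg _)]
    exact supportLowerBound_le_sqrt hA
  · refine IsBigO.of_bound (Real.exp 4) ?_
    filter_upwards [eventually_ge_atTop 1] with A hA
    rw [Real.norm_of_nonneg (show 0 ≤ supportLowerBound A from (Real.exp_pos _).le),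
      Real.norm_of_nonneg (Real.sqrt_nonneg _)]
    have h1 := mul_le_mul_of_nonneg_left (le_supportLowerBound hA) (Real.exp_pos 4).le
    rwa [← mul_assoc, ← Real.exp_add, add_neg_cancel, Real.exp_zero, one_mul] at h1

theorem eventually_four_le_supportLowerBound : ∀ᶠ A : ℝ in atTop, 4 ≤ supportLowerBound A := by
  have h := Real.tendsto_sqrt_atTop.const_mul_atTop (Real.exp_pos (-4))
  filter_upwards [h.eventually_ge_atTop 4, eventually_ge_atTop 1] with A h1 h2
  exact h1.trans (le_supportLowerBound h2)

theorem abs_supportUpperBound_le (hA : Real.exp 1 ≤ A) (hB : 4 ≤ supportLowerBound A) :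
    |supportUpperBound A| ≤ 20 * (A * Real.log A ^ 2) := by
  have he1 := Real.exp_one_gt_d9
  have he2 := Real.exp_one_lt_d9
  have hA1 : 1 ≤ A := by linarith
  have hL : 1 ≤ Real.log A := (Real.le_log_iff_exp_le (by linarith)).mpr hA
  obtain ⟨P, h⟩ := exists_isCapacityAchieving (A := A) (by linarith)
  have hC := capacity_le_log_sqrt_add hA1
  have hC0 := capacity_nonneg A
  rw [Real.log_sqrt (by linarith)] at hC
  have hLA : Real.log A ≤ A := by linarith [Real.log_le_sub_one_of_pos (show 0 < A by linarith)]
  set B := Real.exp (-(capacity A / (1 - Real.exp (-A)))) with hBdef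
  have hB0 : 0 < B := Real.exp_pos _
  have hB4 : B ≤ 1 / 4 := by
    rw [hBdef, Real.exp_neg, one_div]
    exact inv_anti₀ (by norm_num) hB
  have h1 : -3 ≤ Real.log ((1 - 3 * B) / 2) := by
    have h2 := Real.log_le_log (show (0 : ℝ) < 1 / 8 by norm_num)
      (show 1 / 8 ≤ (1 - 3 * B) / 2 by linarith)
    have h3 : Real.log (1 / 8) = -(3 * Real.log 2) := by
      rw [one_div, Real.log_inv, show (8 : ℝ) = 2 ^ 3 by norm_num, Real.log_pow]; norm_num
    linarith [Real.log_two_lt_d9]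
  have h2 : Real.log ((1 - 3 * B) / 2) ≤ 0 :=
    Real.log_nonpos (by linarith) (by linarith)
  have h3 : A ≤ A * Real.log A ^ 2 := le_mul_of_one_le_right (by linarith) (one_le_pow₀ hL)
  have h4 : 2 * Real.exp 1 * A * Real.log A ^ 2 ≤ 6 * (A * Real.log A ^ 2) := by
    have : 0 ≤ A * Real.log A ^ 2 := by positivity
    nlinarith
  have h5 : 0 ≤ 2 * Real.exp 1 * A * Real.log A ^ 2 := by positivity
  rw [supportUpperBound, ← hBdef, abs_le]
  constructor <;> linarith

theorem supportUpperBound_isBigO :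
    supportUpperBound =O[atTop] (fun A : ℝ => A * Real.log A ^ 2) := by
  refine IsBigO.of_bound 20 ?_
  filter_upwards [eventually_four_le_supportLowerBound, eventually_ge_atTop (Real.exp 1)]
    with A h1 h2
  have hA : 0 < A := (Real.exp_pos 1).trans_le h2
  rw [Real.norm_eq_abs, Real.norm_of_nonneg (by positivity)]
  exact abs_supportUpperBound_le h2 h1

end PoissonChannel

end

noncomputable section

namespace PoissonChannel

open Topology

/-! ### The case of a vanishing amplitude -/

variable {P : Measure ℝ}

namespace IsCapacityAchieving

theorem ae_eq_zero (h : IsCapacityAchieving 0 P) : ∀ᵐ x ∂P, x = 0 :=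
  h.1.2.mono fun _ hx => le_antisymm hx.2 hx.1

theorem capacity_zero (h : IsCapacityAchieving 0 P) : capacity 0 = 0 := by
  rw [← h.info_eq, info_eq_zero_of_ae_eq h.1 h.ae_eq_zero]

theorem measureReal_zero (h : IsCapacityAchieving 0 P) : P.real {0} = 1 := by
  have := h.1.1
  have h1 : P {0} = 1 := (mem_ae_iff_prob_eq_one (measurableSet_singleton 0)).mp h.ae_eq_zero
  rw [measureReal_def, h1, ENNReal.toReal_one]

theorem support_zero (h : IsCapacityAchieving 0 P) : P.support = {0} := by
  have := h.1.1
  have h1 := h.1.support_subset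
  rw [Set.Icc_self] at h1
  exact h1.antisymm (Set.singleton_subset_iff.mpr (by
    obtain ⟨x, hx⟩ := Measure.nonempty_support (IsProbabilityMeasure.ne_zero P)
    rwa [← Set.mem_singleton_iff.mp (h1 hx)]))

theorem mom_zero_zero (h : IsCapacityAchieving 0 P) : mom P 0 = 1 := by
  have := h.1.1
  rw [mom, integral_congr_ae (g := fun _ => 1)]
  · simp
  · filter_upwards [h.ae_eq_zero] with x hx
    simp [hx]

end IsCapacityAchieving

end PoissonChannel

end

/-! ### Assembly of the theorem -/

theorem theorem1 :
    (∀ A : ℝ, 0 ≤ A →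
      -- the capacity is finite and attained
      PoissonChannel.capacityENN A ≠ ∞ ∧
      (∃ P : Measure ℝ, PoissonChannel.IsCapacityAchieving A P) ∧
      ∀ P : Measure ℝ, PoissonChannel.IsCapacityAchieving A P →
        -- capacity expression
        PoissonChannel.capacity A = Real.log (1 / (PoissonChannel.outputLaw P).real {0}) ∧
        -- upper bounds on the probabilities
        (∀ x ∈ P.support,
          P.real {x} ≤ Real.exp (-(PoissonChannel.capacity A / (1 - Real.exp (-A))))) ∧
        (∀ x ∈ P.support \ {0},
          P.real {x} ≤ Real.exp (-PoissonChannel.capacity A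
            - x * (Real.exp (-x) / (1 - Real.exp (-x))))) ∧
        (P.support.encard = 2 → ∀ x ∈ P.support \ {0},
          P.real {x} = Real.exp (-PoissonChannel.capacity A
            - x * (Real.exp (-x) / (1 - Real.exp (-x))))) ∧
        -- lower bound on the probability of the largest point
        (4 ≤ Real.exp (PoissonChannel.capacity A / (1 - Real.exp (-A))) →
          (1 - 3 * Real.exp (-(PoissonChannel.capacity A / (1 - Real.exp (-A))))) /
              (2 * A ^ (2 * A * Real.exp 1 * Real.log A + 2) * Real.exp (-2 * A + 1))
            ≤ P.real {A}) ∧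
        -- location of the support points
        (∀ x ∈ P.support \ {0, A},
          Real.exp (-Real.sqrt (2 * (Real.log A - 1)))
              ≤ A * Real.exp (PoissonChannel.lambertWm1 (-1 / A)) ∧
          A * Real.exp (PoissonChannel.lambertWm1 (-1 / A)) ≤ x ∧
          x ≤ A * Real.exp (PoissonChannel.lambertW0 (-1 / A)) ∧
          A * Real.exp (PoissonChannel.lambertW0 (-1 / A)) ≤ A - 1) ∧
        -- lower bound on the size of the support
        P.support.Finite ∧
        PoissonChannel.supportLowerBound A ≤ (P.support.ncard : ℝ) ∧
        -- upper bounds on the size of the support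
        0 < P.real {A} ∧
        (P.support.ncard : ℤ)
          ≤ ⌈A - Real.log (P.real {A}) - PoissonChannel.capacity A⌉ + 2 ∧
        (4 ≤ Real.exp (PoissonChannel.capacity A / (1 - Real.exp (-A))) →
          (P.support.ncard : ℝ) ≤ PoissonChannel.supportUpperBound A)) ∧
    -- orders of the two bounds as `A → ∞`
    PoissonChannel.supportLowerBound =Θ[atTop] (fun A : ℝ => Real.sqrt A) ∧
    PoissonChannel.supportUpperBound =O[atTop] (fun A : ℝ => A * Real.log A ^ 2) ∧
    (∃ c₁ > 0, ∃ c₂ > 0, ∀ᶠ A : ℝ in atTop, ∀ P : Measure ℝ,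
      PoissonChannel.IsCapacityAchieving A P →
        c₁ * Real.sqrt A ≤ (P.support.ncard : ℝ) ∧
        (P.support.ncard : ℝ) ≤ c₂ * (A * Real.log A ^ 2)) := by
  refine ⟨fun A hA => ⟨PoissonChannel.capacityENN_ne_top hA,
    PoissonChannel.exists_isCapacityAchieving hA, fun P h => ?_⟩,
    PoissonChannel.supportLowerBound_isTheta, PoissonChannel.supportUpperBound_isBigO, ?_⟩
  · have := h.1.1
    rw [PoissonChannel.outputLaw_real_singleton h.1, Nat.factorial_zero, Nat.cast_one, div_one]
    rcases hA.eq_or_lt with rfl | hA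
    -- For A = 0 the law is the point mass at 0, and the quotient C/(1 - e^(-A)) is 0/0 = 0, as the
    -- stated convention requires.
    · rw [PoissonChannel.supportLowerBound, h.capacity_zero, h.support_zero, h.measureReal_zero,
        h.mom_zero_zero]
      norm_num
    · refine ⟨by rw [one_div, Real.log_inv]; exact h.capacity_eq hA,
        fun x hx => h.measureReal_le hA hx, fun x hx => h.measureReal_le_of_ne_zero hA hx,
        fun h2 x hx => h.measureReal_eq_of_encard_eq_two hA h2 hx,
        fun hB => h.le_measureReal_right hA hB, fun x hx => ?_, h.finite_support hA,
        h.supportLowerBound_le hA,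
        ENNReal.toReal_pos (h.measure_right_pos hA).ne' (measure_ne_top _ _),
        h.ncard_support_le hA, fun hB => h.ncard_support_le_supportUpperBound hA hB⟩
      obtain ⟨hx0, hxA⟩ := h.mem_Ioo_of_mem_support hx
      exact PoissonChannel.lambert_bounds hx0 hA (h.one_le_mul_log hx.1 hx0 hxA)
  · refine ⟨Real.exp (-4), Real.exp_pos _, 20, by norm_num, ?_⟩
    filter_upwards [PoissonChannel.eventually_four_le_supportLowerBound,
      eventually_ge_atTop (Real.exp 1)] with A hB hAe P h
    have hA1 : 1 ≤ A := by linarith [Real.add_one_le_exp 1]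
    have hA : 0 < A := by linarith
    exact ⟨(PoissonChannel.le_supportLowerBound hA1).trans (h.supportLowerBound_le hA),
      (h.ncard_support_le_supportUpperBound hA hB).trans
        ((le_abs_self _).trans (PoissonChannel.abs_supportUpperBound_le hAe hB))⟩
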